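/- Let $(W,S)$ be a finite Coxeter system with length function $\ell$ and $m_{st}$ the order of $st$. Let $\{u_s\mid s\in S\}$ be indeterminates over $\mathbb{C}$ such that $u_s=u_t$ whenever $s,t\in S$ are conjugate in $W$, and let $\mathbf{K}$ be a finite Galois extension of $\mathbb{C}(u_s\mid s\in S)$. Let $\mathbf{H}$ be the generic Iwahori–Hecke algebra over $\mathbf{K}$: the unital associative $\mathbf{K}$-algebra with generators $T_s$ $(s\in S)$ and relations $T_s^2=(u_s-1)T_s+u_s$ and $T_sT_tT_s\cdots=T_tT_sT_t\cdots$ ($m_{st}$ factors on each side, $s\ne t$). Assume that $\mathbf{K}$ is a splitting field for $\mathbf{H}$, i.e. $\operatorname{End}_{\mathbf{H}}(V)=\mathbf{K}$ for every simple $\mathbf{H}$-module $V$. All $\mathbf{H}$-modules are right modules. For $w\in W$ with reduced expression $w=s_1\cdots s_l$ put $T_w=T_{s_1}\cdots T_{s_l}$, $u_w=u_{s_1}\cdots u_{s_l}$ and $T_w^\vee=u_w^{-1}T_{w^{-1}}$; the elements $T_w$ $(w\in W)$ form a $\mathbf{K}$-basis of $\mathbf{H}$. For an $\mathbf{H}$-module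 $V$ of finite dimension over $\mathbf{K}$ let $\chi_V(h)=\operatorname{tr}(v\mapsto vh)$ be its character and $\chi_V^*=\sum_{w\in W}\chi_V(T_w)T_w^\vee\in\mathbf{H}$. If $V$ is simple, its Schur element is the unique $c_V\in\mathbf{K}$ such that $\sum_{w\in W}\varphi(vT_w)T_w^\vee=c_V\operatorname{tr}(\varphi)\,v$ for all $\varphi\in\operatorname{End}_{\mathbf{K}}(V)$ and $v\in V$. Let $J\subset S$, let $W_J=\langle J\rangle\subset W$, $P_J=\sum_{w\in W_J}u_w$ and $e_J=P_J^{-1}\sum_{w\in W_J}T_w\in\mathbf{H}$. Assume that $(S,J)$ is a Gelfand pair, i.e. the $\mathbf{H}$-module $e_J\mathbf{H}$ is multiplicity-free, and let $e_J\mathbf{H}=\bigoplus_{i=1}^r V_i$ be its decomposition into simple submodules. Put $\chi_i=\chi_{V_i}$, $c_i=c_{V_i}$ and $\omega_i=\chi_i^*e_J$ for $1\le i\le r$. Then: 1. if $\omega_i=\sum_{w\in W}\omega_i(w)T_w$, then $\omega_i(e)=1$, where $e\in W$ is the unit element; 2. $\omega_i\omega_j=\delta_{ij}c_i\omega_i$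 for all $1\le i,j\le r$; 3. $\omega_i\in e_J\mathbf{H}e_J\cap V_i$; 4. $\omega_1,\dots,\omega_r$ form a $\mathbf{K}$-basis of $e_J\mathbf{H}e_J$. -/

import Mathlib

namespace IwahoriHecke

open MulOpposite

universe u v w

section Algebra

variable {B : Type v} {A : Type u} [CommRing A]

/-- The defining relations of the Iwahori-Hecke algebra with parameters `a s`: the quadratic
relations `T_s ^ 2 = (a_s - 1) T_s + a_s` and the braid relations
`T_s T_t T_s ⋯ = T_t T_s T_t ⋯` with `m_{st}` factors on both sides (for `s = t`, where `m = 1`,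
and for `m = ∞`, encoded as `0`, this last relation is trivial). -/
inductive Rel (M : CoxeterMatrix B) (a : B → A) : FreeAlgebra A B → FreeAlgebra A B → Prop
  | quadratic (s : B) : Rel M a (FreeAlgebra.ι A s * FreeAlgebra.ι A s)
      (algebraMap A _ (a s - 1) * FreeAlgebra.ι A s + algebraMap A _ (a s))
  | braid (s t : B) : Rel M a
      ((CoxeterSystem.alternatingWord s t (M s t)).map (FreeAlgebra.ι A)).prod
      ((CoxeterSystem.alternatingWord t s (M s t)).map (FreeAlgebra.ι A)).prod

/-- The Iwahori-Hecke algebra over `A` with parameters `a s`, by generators and relations. -/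
def HeckeAlgebra (M : CoxeterMatrix B) (a : B → A) : Type (max u v) := RingQuot (Rel M a)

variable (M : CoxeterMatrix B) (a : B → A)

noncomputable instance : Ring (HeckeAlgebra M a) := inferInstanceAs (Ring (RingQuot (Rel M a)))

noncomputable instance : Algebra A (HeckeAlgebra M a) :=
  inferInstanceAs (Algebra A (RingQuot (Rel M a)))

/-- The generator `T_s`. -/
noncomputable def gen (s : B) : HeckeAlgebra M a :=
  RingQuot.mkAlgHom A (Rel M a) (FreeAlgebra.ι A s)

end Algebra

section Elements

variable {B : Type v} {W : Type w} [Group W] {M : CoxeterMatrix B} (cs : CoxeterSystem M W)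

/-- A reduced expression of `w`. -/
noncomputable def reducedWord (w : W) : List B := (cs.exists_isReduced w).choose

/-- The parabolic subgroup `W_J`. -/
def parabolic (J : Set B) : Subgroup W := Subgroup.closure (cs.simple '' J)

section

variable {A : Type u} [CommRing A] (a : B → A)

/-- `T_w = T_{s_1} ⋯ T_{s_l}` for a reduced expression `w = s_1 ⋯ s_l`. -/
noncomputable def T (w : W) : HeckeAlgebra M a := ((reducedWord cs w).map (gen M a)).prod

/-- `a_w = a_{s_1} ⋯ a_{s_l}` for a reduced expression `w = s_1 ⋯ s_l`. -/
noncomputable def weight (w : W) : A := ((reducedWord cs w).map a).prod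

end

variable {K : Type u} [Field K] (a : B → K)

/-- The dual basis element `T_w^∨ = a_w⁻¹ T_{w⁻¹}`. -/
noncomputable def TDual (w : W) : HeckeAlgebra M a := (weight cs a w)⁻¹ • T cs a w⁻¹

variable [Fintype W]

/-- `f^* = ∑_w f(T_w) T_w^∨`. -/
noncomputable def star (f : HeckeAlgebra M a → K) : HeckeAlgebra M a :=
  ∑ w : W, f (T cs a w) • TDual cs a w

open Classical in
/-- The Poincaré polynomial `P_J = ∑_{w ∈ W_J} a_w` of `W_J`. -/
noncomputable def poincare (J : Set B) : K :=
  ∑ w ∈ Finset.univ.filter (fun w : W => w ∈ parabolic cs J), weight cs a w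

open Classical in
/-- The idempotent `e_J = P_J⁻¹ ∑_{w ∈ W_J} T_w`. -/
noncomputable def eJ (J : Set B) : HeckeAlgebra M a :=
  (poincare cs a J)⁻¹ •
    ∑ w ∈ Finset.univ.filter (fun w : W => w ∈ parabolic cs J), T cs a w

/-- The right ideal `e_J H`, as a right `H`-module. -/
noncomputable def eJH (J : Set B) : Submodule (HeckeAlgebra M a)ᵐᵒᵖ (HeckeAlgebra M a) :=
  Submodule.span (HeckeAlgebra M a)ᵐᵒᵖ {eJ cs a J}

/-- The subspace `e_J H e_J` of `H`. -/
noncomputable def eJHeJ (J : Set B) : Submodule K (HeckeAlgebra M a) :=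
  LinearMap.range (LinearMap.mulLeftRight K (eJ cs a J, eJ cs a J))

/-- The scalar `c` is the Schur element of the right `H`-module `V`:
`∑_w φ(v T_w) T_w^∨ = c tr(φ) v` for all `K`-linear endomorphisms `φ` of `V` and all `v`. -/
def IsSchurElement (V : Type*) [AddCommGroup V] [Module K V] [Module (HeckeAlgebra M a)ᵐᵒᵖ V]
    (c : K) : Prop :=
  ∀ (φ : V →ₗ[K] V) (v : V),
    ∑ w : W, op (TDual cs a w) • φ (op (T cs a w) • v) = (c * LinearMap.trace K V φ) • v

end Elements

section Modules

/-- The character `h ↦ tr(v ↦ v h)` of a right module `V` over a `K`-algebra `H`. -/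
noncomputable def character (K : Type*) {H : Type*} [Field K] [Ring H] [Algebra K H]
    (V : Type*) [AddCommGroup V] [Module K V] [Module Hᵐᵒᵖ V] [IsScalarTower K Hᵐᵒᵖ V]
    (h : H) : K :=
  LinearMap.trace K V (Algebra.lsmul K K V (op h))

/-- Every simple right `H`-module `V` is split simple: `End_H(V) = K`. (Every simple right
`H`-module is isomorphic to a quotient of `H`, so the universe of `H` is large enough.) -/
def SimplesSplit (K : Type u) (H : Type v) [Field K] [Ring H] [Algebra K H] : Prop :=
  ∀ (V : Type v) [AddCommGroup V] [Module Hᵐᵒᵖ V], IsSimpleModule Hᵐᵒᵖ V →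
    ∀ φ : V →ₗ[Hᵐᵒᵖ] V, ∃ k : K, ∀ x : V, φ x = op (algebraMap K H k) • x

/-- A (semisimple) module is multiplicity-free: no simple module occurs more than once in it,
that is, two isomorphic simple submodules are equal. -/
def IsMultiplicityFree (R : Type*) (N : Type*) [Ring R] [AddCommGroup N] [Module R N] : Prop :=
  ∀ X Y : Submodule R N, IsSimpleModule R X → IsSimpleModule R Y →
    Nonempty (X ≃ₗ[R] Y) → X = Y

end Modules

section Gelfand

variable {B : Type v} {W : Type w} [Group W] [Fintype W] {M : CoxeterMatrix B}
  (cs : CoxeterSystem M W) {K : Type u} [Field K] (a : B → K)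

/-- `(S, J)` is a Gelfand pair: the right `H`-module `e_J H` is multiplicity-free. -/
def IsGelfandPair (J : Set B) : Prop :=
  IsMultiplicityFree (HeckeAlgebra M a)ᵐᵒᵖ (eJH cs a J)

/-- The zonal spherical function `χ_V^* e_J` attached to a simple submodule `V` of `e_J H`. -/
noncomputable def zonal (J : Set B)
    (V : Submodule (HeckeAlgebra M a)ᵐᵒᵖ (HeckeAlgebra M a)) : HeckeAlgebra M a :=
  star cs a (character K V) * eJ cs a J

end Gelfand

/-- The field `ℂ(σ)` of rational functions in the indeterminates `σ`. -/
abbrev RatField (σ : Type*) : Type _ := FractionRing (MvPolynomial σ ℂ)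

/-- The generic parameters `u_s`, in an extension field `K` of `ℂ(σ)`: `u_s` is the
indeterminate with label `p s`. -/
noncomputable def param {B σ : Type*} (p : B → σ) (K : Type*) [Field K] [Algebra (RatField σ) K]
    (s : B) : K :=
  algebraMap (RatField σ) K (algebraMap (MvPolynomial σ ℂ) (RatField σ) (MvPolynomial.X (p s)))

/-- The generic Iwahori-Hecke algebra over `K`. -/
abbrev GenericHecke {B σ : Type*} (M : CoxeterMatrix B) (p : B → σ) (K : Type*) [Field K]
    [Algebra (RatField σ) K] : Type _ :=
  HeckeAlgebra M (param p K)

end IwahoriHecke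

/-! Write `e = e_J` and split it along the decomposition as `e = x_1 + ... + x_r` with `x_i ∈ V_i`.
For `y ∈ V_i` one has `y = e y = ∑ x_j y` with `x_j y ∈ V_j`, so the `x_i` are orthogonal
idempotents (`component_mul`). The element `χ_i^*` is central, acts on `V_i` by `c_i`, and kills
`V_j` for `j ≠ i`, because multiplicity-freeness leaves no nonzero map `V_i → V_j`. Hence `ω_i =
χ_i^* e = c_i x_i` (`IsSymmetrizing.sum_character_mul_eq_smul_component`), which gives the product
formula and the memberships.

Left multiplication by `y ∈ V_i` is a module map `V_j → V_i`, so it is zero for `j ≠ i` and a scalar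
for `j = i`; thus `V_i e = K x_i` (`exists_mul_eq_smul_component`). Consequently the `x_i` span `e H
e`, and `e` acts on `V_i` with trace one. If `τ` is the coefficient of `T_1`, the coefficient in
question is `τ(χ_i^* e) = χ_i(e) = 1`. In particular `c_i ≠ 0`, and the `ω_i` form a basis along
with the `x_i`.

All this rests on `H` being symmetric: the `T_w` are a basis, `τ` is a trace form, and the `T_w^∨`
are the dual basis (`isSymmetrizing_TDual`). Matsumoto's theorem (`prod_map_eq_of_isReduced`) frees
`T_w` and `u_w` from the choice of a reduced word; commuting left and right operators on the free
module on `W` give linear independence. Both need alternating words of length at most `m_{st}` to be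
reduced, hence the exact order of `st`, which the geometric representation supplies. -/

namespace CoxeterSystem

open Polynomial.Chebyshev

/-! ### The geometric representation and the order of a product of two simple reflections -/

section Geometric

variable {B W : Type*} [Group W] {M : CoxeterMatrix B}

/-- The functional `2 ⟨α_i, ·⟩` of the geometric representation of a Coxeter matrix. -/
noncomputable def coroot (M : CoxeterMatrix B) (i : B) : Module.Dual ℝ (B →₀ ℝ) :=
  Finsupp.linearCombination ℝ fun j => -2 * Real.cos (Real.pi / M i j)

theorem coroot_single (i j : B) :
    coroot M i (Finsupp.single j 1) = -2 * Real.cos (Real.pi / M i j) := by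
  simp [coroot]

theorem coroot_single_self (i : B) : coroot M i (Finsupp.single i 1) = 2 := by
  simp [coroot_single]

/-- The simple reflections of the geometric representation. -/
noncomputable def geomReflection (M : CoxeterMatrix B) (i : B) :
    (B →₀ ℝ) ≃ₗ[ℝ] (B →₀ ℝ) :=
  Module.reflection (coroot_single_self (M := M) i)

theorem coroot_mul_coroot (i j : B) :
    coroot M i (Finsupp.single j 1) * coroot M j (Finsupp.single i 1) - 2 =
      2 * Real.cos (2 * Real.pi / M i j) := by
  rw [coroot_single, coroot_single, M.symmetric j i, mul_div_assoc, Real.cos_two_mul]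
  ring

theorem sin_two_pi_div_pos {m : ℕ} (hm : 3 ≤ m) : 0 < Real.sin (2 * Real.pi / m) := by
  have hm' : (3 : ℝ) ≤ m := by exact_mod_cast hm
  have := Real.pi_pos
  apply Real.sin_pos_of_pos_of_lt_pi
  · positivity
  · rw [div_lt_iff₀ (by positivity)]
    nlinarith

theorem cos_pi_div_pos {m : ℕ} (hm : 3 ≤ m) : 0 < Real.cos (Real.pi / m) := by
  have hm' : (3 : ℝ) ≤ m := by exact_mod_cast hm
  have := Real.pi_pos
  apply Real.cos_pos_of_mem_Ioo
  constructor
  · have : 0 < Real.pi / m := by positivity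
    linarith
  · rw [div_lt_div_iff₀ (by positivity) (by positivity)]
    nlinarith

theorem eq_of_apply_eq_one {i j : B} (h : M i j = 1) : i = j := by
  by_contra hij
  exact M.off_diagonal i j hij h

/-- Powers of a product of two reflections have coefficients that are Chebyshev polynomials `S` at
`2 cos θ`, `θ = 2π/m`. There `S_n` equals `sin((n+1)θ) / sin θ`, and every correction term in the
`m`-th power has a vanishing factor: `S_{k-1}` for `m = 2k`, and `S_k + S_{k-1}` for `m = 2k+1`. -/
theorem geomReflection_isLiftable (M : CoxeterMatrix B) : M.IsLiftable (geomReflection M) := by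
  intro i j
  -- The cases `m = 1, 2` are separate because `sin θ` vanishes there and the quotient formula
  -- fails.
  obtain h | h | h | h : M i j = 0 ∨ M i j = 1 ∨ M i j = 2 ∨ 3 ≤ M i j := by omega
  · simp [h]
  · obtain rfl := eq_of_apply_eq_one h
    rw [h, pow_one]
    ext1 x
    rw [LinearEquiv.mul_apply, geomReflection]
    exact Module.involutive_reflection (coroot_single_self (M := M) i) x
  · ext1 z
    have hij : coroot M i (Finsupp.single j 1) = 0 := by simp [coroot_single, h]
    have hji : coroot M j (Finsupp.single i 1) = 0 := by
      simp [coroot_single, M.symmetric j i, h]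
    rw [geomReflection, geomReflection, Module.reflection_mul_reflection_pow_apply, h, hij, hji]
    norm_num
    abel
  · have hs := sin_two_pi_div_pos h
    have hm0 : (M i j : ℝ) ≠ 0 := by
      have : M i j ≠ 0 := by omega
      exact_mod_cast this
    set θ := 2 * Real.pi / M i j with hθ
    have hmθ : M i j * θ = 2 * Real.pi := by rw [hθ]; field_simp
    ext1 z
    rw [geomReflection, geomReflection, Module.reflection_mul_reflection_pow_apply,
      coroot_mul_coroot, ← hθ]
    have hS (n : ℤ) : (S ℝ n).eval (2 * Real.cos θ) = Real.sin ((n + 1) * θ) / Real.sin θ := by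
      rw [eq_div_iff hs.ne', S_two_mul_real_cos]
    obtain ⟨k, hk | hk⟩ := Nat.even_or_odd' (M i j)
    · have h1 : ((M i j : ℤ) - 2) / 2 = k - 1 := by omega
      have h2 : ((M i j : ℤ) - 1) / 2 = k - 1 := by omega
      have h0 : (S ℝ (k - 1)).eval (2 * Real.cos θ) = 0 := by
        rw [hS]
        have : ((((k : ℤ) - 1 : ℤ) : ℝ) + 1) * θ = Real.pi := by
          rw [hk] at hmθ
          push_cast at hmθ ⊢
          linarith
        rw [this]; simp
      rw [h1, h2, h0]
      simp
    · have h1 : ((M i j : ℤ) - 2) / 2 = k - 1 := by omega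
      have h2 : ((M i j : ℤ) - 1) / 2 = k := by omega
      have h3 : ((M i j : ℤ) - 3) / 2 = k - 1 := by omega
      have h4 : (M i j : ℤ) / 2 = k := by omega
      have h0 : (S ℝ k).eval (2 * Real.cos θ) + (S ℝ (k - 1)).eval (2 * Real.cos θ) = 0 := by
        rw [hS, hS]
        have : (((k : ℤ) : ℝ) + 1) * θ = 2 * Real.pi - ((((k : ℤ) - 1 : ℤ) : ℝ) + 1) * θ := by
          rw [hk] at hmθ
          push_cast at hmθ ⊢
          linarith
        rw [this, Real.sin_two_pi_sub]
        ring
      rw [h1, h2, h3, h4, h0]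
      simp

/-- Evaluating at the simple root `α_i` and comparing coefficients gives, for `m ≥ 3`, `S_{n-1} = 0`
and `S_n = 1` at `2 cos θ`. These force `sin(nθ) = 0` and `cos(nθ) = 1`, so `nθ` is a multiple of
`2π`. -/
theorem dvd_of_geomReflection_pow_eq_one {i j : B} {n : ℕ}
    (hn : (geomReflection M i * geomReflection M j) ^ n = 1) : M i j ∣ n := by
  by_cases hij : i = j
  · subst hij; simp
  have h1 : M i j ≠ 1 := fun h => hij (eq_of_apply_eq_one h)
  have key := congrArg (fun g => g (Finsupp.single i 1)) hn
  simp only [geomReflection, LinearEquiv.coe_one, id_eq] at key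
  rw [Module.reflection_mul_reflection_pow_apply_self, coroot_mul_coroot] at key
  have ki := DFunLike.congr_fun key i
  have kj := DFunLike.congr_fun key j
  simp only [Finsupp.add_apply, Finsupp.smul_apply, Finsupp.single_eq_same,
    Finsupp.single_eq_of_ne hij, Finsupp.single_eq_of_ne (Ne.symm hij), smul_eq_mul, mul_zero,
    mul_one, add_zero, zero_add, coroot_single, M.symmetric j i] at ki kj
  obtain h | h | h : M i j = 0 ∨ M i j = 2 ∨ 3 ≤ M i j := by omega
  -- For `m = 0` the convention `π / 0 = 0` puts the Chebyshev argument at `2`, where `S_{n-1}`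
  -- takes the value `n`.
  · have : n = 0 := by simpa [h, S_eval_two] using kj
    simp [this]
  · have h2 : 2 * Real.cos (2 * Real.pi / (2 : ℕ)) = -2 := by
      rw [Nat.cast_ofNat, mul_div_cancel_left₀ _ two_ne_zero]; simp
    rw [h, h2, S_eval_neg_two, S_eval_neg_two, Int.negOnePow_sub] at ki
    rw [h]
    by_contra hodd
    have hodd' : Odd (n : ℤ) := by
      rw [← even_iff_two_dvd, Nat.not_even_iff_odd] at hodd
      exact_mod_cast hodd
    rw [Int.negOnePow_odd _ hodd'] at ki
    norm_num at ki
  · have hs := sin_two_pi_div_pos h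
    have hc := cos_pi_div_pos h
    have hm0 : (M i j : ℝ) ≠ 0 := by
      have : M i j ≠ 0 := by omega
      exact_mod_cast this
    set θ := 2 * Real.pi / M i j with hθ
    have hS (n : ℤ) := S_two_mul_real_cos θ n
    have kj' : (S ℝ (n - 1)).eval (2 * Real.cos θ) = 0 := by
      rcases mul_eq_zero.mp kj with h | h
      · exact h
      · exfalso; linarith
    have e1 := hS (n - 1)
    have e2 := hS n
    rw [kj', add_zero] at ki
    rw [kj'] at e1
    rw [ki] at e2
    push_cast at e1 e2
    rw [zero_mul, sub_add_cancel] at e1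
    rw [one_mul, add_mul, one_mul, Real.sin_add, ← e1, zero_mul, zero_add] at e2
    have hcos : Real.cos (n * θ) = 1 := by
      have : (Real.cos (n * θ) - 1) * Real.sin θ = 0 := by linarith
      rcases mul_eq_zero.mp this with h | h
      · linarith
      · exact absurd h hs.ne'
    obtain ⟨k, hk⟩ := (Real.cos_eq_one_iff _).mp hcos
    rw [hθ] at hk
    have : (k : ℝ) * M i j = n := by
      field_simp at hk
      have := Real.pi_pos
      nlinarith
    have h3 : (k : ℤ) * (M i j : ℤ) = n := by exact_mod_cast this
    exact Int.natCast_dvd_natCast.mp ⟨k, by rw [← h3, mul_comm]⟩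

/-- The order of a product of two simple reflections is the entry of the Coxeter matrix. -/
theorem orderOf_simple_mul_simple (cs : CoxeterSystem M W) (i j : B) :
    orderOf (cs.simple i * cs.simple j) = M i j := by
  apply Nat.dvd_antisymm (orderOf_dvd_of_pow_eq_one (cs.simple_mul_simple_pow i j))
  apply dvd_of_geomReflection_pow_eq_one
  have h := congrArg (cs.lift ⟨_, geomReflection_isLiftable M⟩)
    (pow_orderOf_eq_one (cs.simple i * cs.simple j))
  rwa [map_pow, map_mul, map_one, lift_apply_simple, lift_apply_simple] at h

end Geometric

end CoxeterSystem

namespace CoxeterSystem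

/-! ### Inversions modulo two, the exchange condition and Matsumoto's theorem -/

section Exchange

variable {B W : Type*} [Group W] {M : CoxeterMatrix B} (cs : CoxeterSystem M W)

open Classical in
/-- The truth value of a proposition modulo two. -/
noncomputable def truthValue (p : Prop) : ZMod 2 := if p then 1 else 0

/-- The action of a simple reflection on pairs of a group element and a sign, which records
inversions modulo two. -/
noncomputable def signAction (i : B) : Function.End (W × ZMod 2) := fun x =>
  (cs.simple i * x.1 * cs.simple i, x.2 + truthValue (x.1 = cs.simple i))

theorem end_mul_apply {X : Type*} (f g : Function.End X) (x : X) : (f * g) x = f (g x) := rfl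

theorem simple_mul_pow (i j : B) (n : ℕ) :
    cs.simple j * (cs.simple i * cs.simple j) ^ n =
      ((cs.simple i * cs.simple j) ^ n)⁻¹ * cs.simple j := by
  induction n with
  | zero => simp
  | succ n ih =>
    rw [pow_succ, ← mul_assoc, ih, ← pow_succ, pow_succ', mul_inv_rev]
    simp [mul_assoc]

theorem signAction_mul_pow_apply (i j : B) (k : ℕ) (x : W × ZMod 2) :
    ((cs.signAction i * cs.signAction j) ^ k) x =
      ((cs.simple i * cs.simple j) ^ k * x.1 * ((cs.simple i * cs.simple j) ^ k)⁻¹,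
        x.2 + ∑ n ∈ Finset.range (2 * k),
          truthValue (x.1 = ((cs.simple i * cs.simple j) ^ n)⁻¹ * cs.simple j)) := by
  induction k with
  | zero => simp [Function.End.one_def]
  | succ k ih =>
    set r := cs.simple i * cs.simple j with hr
    have hc : cs.simple j * r ^ k = (r ^ k)⁻¹ * cs.simple j := cs.simple_mul_pow i j k
    have e1 : r ^ k * x.1 * (r ^ k)⁻¹ = cs.simple j ↔
        x.1 = (r ^ (2 * k))⁻¹ * cs.simple j := by
      rw [mul_inv_eq_iff_eq_mul, hc, two_mul, pow_add, mul_inv_rev, mul_assoc,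
        ← eq_inv_mul_iff_mul_eq]
    have e2 : cs.simple j * (r ^ k * x.1 * (r ^ k)⁻¹) * cs.simple j = cs.simple i ↔
        x.1 = (r ^ (2 * k + 1))⁻¹ * cs.simple j := by
      have h : (r ^ (2 * k + 1))⁻¹ * cs.simple j =
          (r ^ k)⁻¹ * (cs.simple j * cs.simple i * cs.simple j) * r ^ k := by
        rw [show 2 * k + 1 = k + (1 + k) by omega, pow_add, pow_add, pow_one]
        simp only [mul_inv_rev, mul_assoc, hc]
        simp [hr, mul_assoc]
      rw [h]
      constructor
      · intro h
        rw [← h]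
        simp [mul_assoc]
      · intro h
        rw [h]
        simp [mul_assoc]
    rw [pow_succ', end_mul_apply, ih, end_mul_apply]
    simp only [signAction, e1, e2]
    rw [show 2 * (k + 1) = 2 * k + 1 + 1 by ring, Finset.sum_range_succ, Finset.sum_range_succ]
    refine Prod.ext ?_ ?_
    · simp only [pow_succ', hr, mul_inv_rev, cs.inv_simple, mul_assoc]
    · simp only [add_assoc]

theorem signAction_isLiftable : M.IsLiftable cs.signAction := by
  intro i j
  funext x
  -- The sum over `2m` indices runs through a period of length `m` twice, so it vanishes modulo two.
  rw [signAction_mul_pow_apply, cs.simple_mul_simple_pow, two_mul, Finset.sum_range_add]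
  have h (n : ℕ) : (cs.simple i * cs.simple j) ^ (M i j + n) = (cs.simple i * cs.simple j) ^ n := by
    rw [pow_add, cs.simple_mul_simple_pow, one_mul]
  simp only [h, CharTwo.add_self_eq_zero]
  simp [Function.End.one_def]

open Classical in
theorem lift_signAction_wordProd (ω : List B) (x : W × ZMod 2) :
    cs.lift ⟨_, cs.signAction_isLiftable⟩ (cs.wordProd ω) x =
      (cs.wordProd ω * x.1 * (cs.wordProd ω)⁻¹, x.2 + ((cs.rightInvSeq ω).count x.1 : ℕ)) := by
  induction ω with
  | nil => simp [Function.End.one_def]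
  | cons i ω ih =>
    rw [wordProd_cons, map_mul, end_mul_apply, ih, lift_apply_simple]
    simp only [signAction, rightInvSeq, List.count_cons]
    refine Prod.ext ?_ ?_
    · simp [mul_assoc]
    · have : cs.wordProd ω * x.1 * (cs.wordProd ω)⁻¹ = cs.simple i ↔
          (cs.wordProd ω)⁻¹ * cs.simple i * cs.wordProd ω = x.1 := by
        rw [mul_inv_eq_iff_eq_mul, ← eq_inv_mul_iff_mul_eq, mul_assoc, eq_comm]
      simp only [this, beq_iff_eq, truthValue]
      push_cast
      ring_nf

open Classical in
-- The sign action is an action of the group, so the parity it records depends on the product of the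
-- word only.
theorem count_rightInvSeq_eq {ω ω' : List B} (h : cs.wordProd ω = cs.wordProd ω') (t : W) :
    ((cs.rightInvSeq ω).count t : ZMod 2) = (cs.rightInvSeq ω').count t := by
  have h1 := cs.lift_signAction_wordProd ω (t, 0)
  rw [h, lift_signAction_wordProd] at h1
  simpa using (congrArg Prod.snd h1).symm

/-- Words with the same product and without repeated inversions have the same inversions. -/
theorem mem_rightInvSeq_of_nodup {ω ω' : List B} (h : cs.wordProd ω = cs.wordProd ω')
    (hω : (cs.rightInvSeq ω).Nodup) {t : W} (ht : t ∈ cs.rightInvSeq ω) :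
    t ∈ cs.rightInvSeq ω' := by
  classical
  have h1 := cs.count_rightInvSeq_eq h t
  rw [List.count_eq_one_of_mem hω ht] at h1
  by_contra h2
  rw [List.count_eq_zero_of_not_mem h2] at h1
  simp at h1

/-- A reduced word of the same element has the same inversions, also without repetition, hence the
same length. -/
theorem isReduced_of_nodup_rightInvSeq {ω : List B} (hω : (cs.rightInvSeq ω).Nodup) :
    cs.IsReduced ω := by
  classical
  obtain ⟨ω', hr, hω'⟩ := cs.exists_isReduced (cs.wordProd ω)
  have hp : (cs.rightInvSeq ω).Perm (cs.rightInvSeq ω') :=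
    (List.perm_ext_iff_of_nodup hω hr.nodup_rightInvSeq).mpr fun t =>
      ⟨cs.mem_rightInvSeq_of_nodup hω' hω, cs.mem_rightInvSeq_of_nodup hω'.symm hr.nodup_rightInvSeq⟩
  have := hp.length_eq
  rw [length_rightInvSeq, length_rightInvSeq] at this
  rw [IsReduced, hω', hr.eq, this]

theorem IsReduced.append_simple {cs : CoxeterSystem M W} {ω : List B} (hω : cs.IsReduced ω) {j : B}
    (h : cs.length (cs.wordProd ω) < cs.length (cs.wordProd ω * cs.simple j)) :
    cs.IsReduced (ω ++ [j]) := by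
  rw [IsReduced, wordProd_append, wordProd_singleton, List.length_append, ← hω.eq]
  rcases cs.length_mul_simple (cs.wordProd ω) j with h1 | h1
  · exact h1
  · omega

/-- The exchange condition. -/
theorem IsReduced.exchange {cs : CoxeterSystem M W} (ω : List B) {j : B}
    (h : cs.IsRightDescent (cs.wordProd ω) j) :
    ∃ k < ω.length, cs.wordProd ω * cs.simple j = cs.wordProd (ω.eraseIdx k) := by
  -- Appending `j` to a reduced word of the shorter element makes `s_j` an inversion; it then occurs
  -- in the sequence of `ω`, and its position there is the letter to delete.
  obtain ⟨ω', hr, hω'⟩ := cs.exists_isReduced (cs.wordProd ω * cs.simple j)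
  have hp : cs.wordProd (ω' ++ [j]) = cs.wordProd ω := by
    rw [wordProd_append, ← hω']; simp
  have hr' : cs.IsReduced (ω' ++ [j]) := by
    apply hr.append_simple
    rw [← hω']
    simpa [IsRightDescent] using h
  have hj : cs.simple j ∈ cs.rightInvSeq (ω' ++ [j]) := by
    rw [← List.concat_eq_append, rightInvSeq_concat]
    simp
  have hmem := cs.mem_rightInvSeq_of_nodup hp hr'.nodup_rightInvSeq hj
  obtain ⟨k, hk, hk'⟩ := List.mem_iff_getElem.mp hmem
  refine ⟨k, by simpa using hk, ?_⟩
  rw [← wordProd_mul_getD_rightInvSeq, List.getD_eq_getElem _ _ hk, hk']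

/-- Exchange removes a letter from a word `s :: ω` of `s w`. Removing `s` gives the equality;
removing a letter of `ω` would make `w t` shorter than `w`. -/
theorem eq_of_length_simple_mul_simple {w : W} {s t : B}
    (hs : cs.length w < cs.length (cs.simple s * w)) (ht : cs.length w < cs.length (w * cs.simple t))
    (hst : cs.length (cs.simple s * w * cs.simple t) = cs.length w) :
    cs.simple s * w = w * cs.simple t := by
  obtain ⟨ω, hr, rfl⟩ := cs.exists_isReduced w
  have hd : cs.IsRightDescent (cs.wordProd (s :: ω)) t := by
    rw [IsRightDescent, wordProd_cons, hst]; exact hs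
  obtain ⟨k, hk, hk'⟩ := IsReduced.exchange _ hd
  rw [wordProd_cons] at hk'
  cases k with
  | zero =>
    rw [List.eraseIdx_cons_zero] at hk'
    rw [← mul_left_inj (cs.simple t), hk']
    simp
  | succ k =>
    exfalso
    rw [List.eraseIdx_cons_succ, wordProd_cons, mul_assoc, mul_right_inj] at hk'
    rw [hk'] at ht
    have h1 := cs.length_wordProd_le (ω.eraseIdx k)
    have h2 := List.length_eraseIdx_le ω k
    rw [hr.eq] at ht
    omega

/-- With `r = s_i s_j` the inversions are `r⁻ⁿ s_j` for `n < k`; they are distinct because `r` has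
order exactly `M i j`. -/
theorem nodup_rightInvSeq_alternatingWord (i j : B) {k : ℕ} (hk : M i j = 0 ∨ k ≤ M i j) :
    (cs.rightInvSeq (alternatingWord i j k)).Nodup ∧
      ∀ t ∈ cs.rightInvSeq (alternatingWord i j k),
        ∃ n < k, t = ((cs.simple i * cs.simple j) ^ n)⁻¹ * cs.simple j := by
  induction k with
  | zero => simp [alternatingWord]
  | succ k ih =>
    obtain ⟨ih1, ih2⟩ := ih (by omega)
    have hhead : (cs.wordProd (alternatingWord i j k))⁻¹ *
        cs.simple (if Even k then j else i) * cs.wordProd (alternatingWord i j k) =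
        ((cs.simple i * cs.simple j) ^ k)⁻¹ * cs.simple j := by
      set r := cs.simple i * cs.simple j with hr
      have hc (n : ℕ) : cs.simple j * r ^ n = (r ^ n)⁻¹ * cs.simple j := cs.simple_mul_pow i j n
      rw [prod_alternatingWord_eq_mul_pow, ← hr]
      obtain ⟨n, rfl | rfl⟩ := Nat.even_or_odd' k
      · simp only [even_two, Even.mul_right, if_true, one_mul, mul_assoc,
          Nat.mul_div_cancel_left _ two_pos]
        rw [hc, ← mul_assoc, ← mul_inv_rev, ← pow_add, two_mul]
      · have h1 : ¬ Even (2 * n + 1) := by simp [parity_simps]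
        have h2 : (2 * n + 1) / 2 = n := by omega
        have h3 : r ^ (2 * n + 1) = r ^ n * r * r ^ n := by
          rw [two_mul, ← pow_succ, ← pow_add]; congr 1; omega
        rw [if_neg h1, if_neg h1, h2, h3]
        simp only [mul_inv_rev, mul_assoc, ← hc]
        simp [hr, mul_assoc]
    rw [alternatingWord_succ', rightInvSeq, hhead]
    refine ⟨List.nodup_cons.mpr ⟨?_, ih1⟩, ?_⟩
    · intro hmem
      obtain ⟨n, hn, he⟩ := ih2 _ hmem
      rw [mul_left_inj, inv_inj, pow_eq_pow_iff_modEq, orderOf_simple_mul_simple] at he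
      rcases hk with hk | hk
      · rw [hk, Nat.modEq_zero_iff] at he
        omega
      · rw [Nat.ModEq, Nat.mod_eq_of_lt (by omega), Nat.mod_eq_of_lt (by omega)] at he
        omega
    · intro t ht
      rcases List.mem_cons.mp ht with rfl | ht
      · exact ⟨k, by omega, rfl⟩
      · obtain ⟨n, hn, he⟩ := ih2 _ ht
        exact ⟨n, by omega, he⟩

theorem isReduced_alternatingWord (i j : B) {k : ℕ} (hk : M i j = 0 ∨ k ≤ M i j) :
    cs.IsReduced (alternatingWord i j k) :=
  cs.isReduced_of_nodup_rightInvSeq (cs.nodup_rightInvSeq_alternatingWord i j hk).1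

/-- The alternating suffix is lengthened one letter at a time by exchange, using the two descents in
turn. The deleted letter cannot lie in the suffix, since the longer alternating word is itself
reduced. -/
theorem exists_eq_mul_alternatingWord {w : W} {s t : B}
    (hs : cs.IsRightDescent w s) (ht : cs.IsRightDescent w t) {k : ℕ}
    (hk : M s t = 0 ∨ k ≤ M s t) :
    (∃ ω, cs.IsReduced (ω ++ alternatingWord s t k) ∧
      w = cs.wordProd (ω ++ alternatingWord s t k)) ∧
    (∃ ω, cs.IsReduced (ω ++ alternatingWord t s k) ∧
      w = cs.wordProd (ω ++ alternatingWord t s k)) := by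
  have step {s t : B} {k : ℕ} (hs : cs.IsRightDescent w s) (hk : M t s = 0 ∨ k + 1 ≤ M t s)
      (h : ∃ ω, cs.IsReduced (ω ++ alternatingWord s t k) ∧
        w = cs.wordProd (ω ++ alternatingWord s t k)) :
      ∃ ω, cs.IsReduced (ω ++ alternatingWord t s (k + 1)) ∧
        w = cs.wordProd (ω ++ alternatingWord t s (k + 1)) := by
    obtain ⟨ω, hr, rfl⟩ := h
    obtain ⟨n, hn, he⟩ := IsReduced.exchange _ hs
    rw [List.length_append, length_alternatingWord] at hn
    by_cases hnl : n < ω.length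
    · rw [List.eraseIdx_append_of_lt_length hnl] at he
      have he' : cs.wordProd (ω ++ alternatingWord s t k) =
          cs.wordProd (ω.eraseIdx n ++ alternatingWord t s (k + 1)) := by
        rw [alternatingWord_succ, List.concat_eq_append, ← List.append_assoc, wordProd_append _ _ [s],
          wordProd_singleton, ← he]
        simp
      refine ⟨_, ?_, he'⟩
      rw [IsReduced, ← he', hr.eq]
      simp [List.length_eraseIdx_of_lt hnl]
      omega
    · exfalso
      rw [List.eraseIdx_append_of_length_le (by omega), wordProd_append, wordProd_append, mul_assoc,
        mul_right_inj, ← wordProd_concat, ← alternatingWord_succ] at he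
      have h1 := (cs.isReduced_alternatingWord t s hk).eq
      rw [he, length_alternatingWord] at h1
      have h2 := cs.length_wordProd_le ((alternatingWord s t k).eraseIdx (n - ω.length))
      have h3 := List.length_eraseIdx_le (alternatingWord s t k) (n - ω.length)
      rw [length_alternatingWord] at h3
      omega
  induction k with
  | zero =>
    obtain ⟨ω, hr, hω⟩ := cs.exists_isReduced w
    exact ⟨⟨ω, by simpa [alternatingWord] using ⟨hr, hω⟩⟩,
      ⟨ω, by simpa [alternatingWord] using ⟨hr, hω⟩⟩⟩
  | succ k ih =>
    obtain ⟨h1, h2⟩ := ih (by omega)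
    exact ⟨step ht hk h2, step hs (by rwa [M.symmetric]) h1⟩

theorem apply_ne_zero_of_isRightDescent {w : W} {s t : B}
    (hs : cs.IsRightDescent w s) (ht : cs.IsRightDescent w t) : M s t ≠ 0 := by
  intro h
  obtain ⟨⟨ω, hr, hω⟩, -⟩ :=
    cs.exists_eq_mul_alternatingWord hs ht (k := cs.length w + 1) (Or.inl h)
  have := hr.eq
  rw [← hω, List.length_append, length_alternatingWord] at this
  omega

theorem IsReduced.isRightDescent_append {cs : CoxeterSystem M W} {ω : List B} {s : B}
    (h : cs.IsReduced (ω ++ [s])) : cs.IsRightDescent (cs.wordProd (ω ++ [s])) s := by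
  rw [IsRightDescent, h.eq, wordProd_append, wordProd_singleton, simple_mul_simple_cancel_right,
    List.length_append]
  have := cs.length_wordProd_le ω
  simp only [List.length_singleton]
  omega

theorem IsReduced.of_append {cs : CoxeterSystem M W} {ω ω' : List B}
    (h : cs.IsReduced (ω ++ ω')) : cs.IsReduced ω := by
  simpa using h.take ω.length

/-- Matsumoto's theorem: a function on the generators with values in a monoid which satisfies the
braid relations has the same product along any two reduced words of the same element. -/
theorem prod_map_eq_of_isReduced {N : Type*} [Monoid N] {f : B → N}
    (hf : ∀ s t : B, ((alternatingWord s t (M s t)).map f).prod =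
      ((alternatingWord t s (M s t)).map f).prod)
    {ω ω' : List B} (hω : cs.IsReduced ω) (hω' : cs.IsReduced ω')
    (h : cs.wordProd ω = cs.wordProd ω') : (ω.map f).prod = (ω'.map f).prod := by
  induction hn : ω.length using Nat.strong_induction_on generalizing ω ω' with
  | _ n ih =>
  have hlen : ω.length = ω'.length := by rw [← hω.eq, ← hω'.eq, h]
  have same {ω ω' : List B} {s : B} (hω : cs.IsReduced (ω ++ [s])) (hω' : cs.IsReduced (ω' ++ [s]))
      (h : cs.wordProd (ω ++ [s]) = cs.wordProd (ω' ++ [s])) (hn : (ω ++ [s]).length = n) :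
      ((ω ++ [s]).map f).prod = ((ω' ++ [s]).map f).prod := by
    have h1 := ih ω.length (by simp at hn; omega) hω.of_append hω'.of_append
      (by simpa [wordProd_append] using h) rfl
    simp [h1]
  rcases List.eq_nil_or_concat ω with rfl | ⟨ω₁, s, rfl⟩
  · rw [List.length_nil] at hlen
    rw [List.length_eq_zero_iff.mp hlen.symm]
  rcases List.eq_nil_or_concat ω' with rfl | ⟨ω₁', t, rfl⟩
  · simp at hlen
  simp only [List.concat_eq_append] at *
  by_cases hst : s = t
  · subst hst
    exact same hω hω' h hn
  have hs := hω.isRightDescent_append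
  have ht := hω'.isRightDescent_append
  rw [← h] at ht
  have hM := cs.apply_ne_zero_of_isRightDescent hs ht
  obtain ⟨k, hk⟩ := Nat.exists_eq_succ_of_ne_zero hM
  -- The words end in different letters `s` and `t`. Two intermediate words, differing by one braid
  -- relation, share their last letters with `ω` and `ω'` respectively, so induction applies at both
  -- ends.
  obtain ⟨⟨ω₂, hr, hw⟩, -⟩ := cs.exists_eq_mul_alternatingWord hs ht (Or.inr le_rfl)
  have hw' : cs.wordProd (ω₂ ++ alternatingWord s t (M s t)) =
      cs.wordProd (ω₂ ++ alternatingWord t s (M s t)) := by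
    have := cs.wordProd_braidWord_eq s t
    rw [braidWord, braidWord, M.symmetric t s] at this
    rw [wordProd_append, wordProd_append, this]
  have hr' : cs.IsReduced (ω₂ ++ alternatingWord t s (M s t)) := by
    rw [IsReduced, ← hw', hr.eq]; simp
  have key : ((ω₂ ++ alternatingWord s t (M s t)).map f).prod =
      ((ω₂ ++ alternatingWord t s (M s t)).map f).prod := by
    simp [hf s t]
  simp only [hk, Nat.succ_eq_add_one, alternatingWord_succ, List.concat_eq_append,
    ← List.append_assoc] at hr hr' hw hw' key
  have l1 := hr.eq
  have l2 := hr'.eq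
  rw [← hw, hω.eq] at l1
  rw [← hw', ← hw, hω.eq] at l2
  rw [same hω hr' (hw.trans hw') hn, ← key]
  exact same hr hω' (hw.symm.trans h) (l1.symm.trans hn)

end Exchange

end CoxeterSystem

namespace IwahoriHecke

open CoxeterSystem

universe u v w

/-! ### The standard basis of the Hecke algebra and its canonical trace -/

section Basis

variable {B : Type v} {W : Type w} [Group W] {M : CoxeterMatrix B} (cs : CoxeterSystem M W)
  {A : Type u} [CommRing A] {a : B → A}

theorem gen_mul_gen (M : CoxeterMatrix B) (a : B → A) (s : B) :
    gen M a s * gen M a s = (a s - 1) • gen M a s + a s • 1 := by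
  have h := RingQuot.mkAlgHom_rel A (Rel.quadratic (M := M) (a := a) s)
  rw [map_mul, map_add, map_mul, AlgHom.commutes, AlgHom.commutes, ← Algebra.smul_def,
    Algebra.algebraMap_eq_smul_one] at h
  exact h

theorem gen_braid (M : CoxeterMatrix B) (a : B → A) (s t : B) :
    ((alternatingWord s t (M s t)).map (gen M a)).prod =
      ((alternatingWord t s (M s t)).map (gen M a)).prod := by
  have h := RingQuot.mkAlgHom_rel A (Rel.braid (M := M) (a := a) s t)
  rw [map_list_prod, map_list_prod, List.map_map, List.map_map] at h
  exact h

theorem isReduced_reducedWord (w : W) : cs.IsReduced (reducedWord cs w) :=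
  (cs.exists_isReduced w).choose_spec.1

theorem wordProd_reducedWord (w : W) : cs.wordProd (reducedWord cs w) = w :=
  (cs.exists_isReduced w).choose_spec.2.symm

theorem T_wordProd {ω : List B} (hω : cs.IsReduced ω) :
    T cs a (cs.wordProd ω) = (ω.map (gen M a)).prod :=
  cs.prod_map_eq_of_isReduced (gen_braid M a) (isReduced_reducedWord cs _) hω
    (wordProd_reducedWord cs _)

theorem prod_map_alternatingWord_two_mul (a : B → A) (s t : B) (k : ℕ) :
    ((alternatingWord s t (2 * k)).map a).prod = (a s * a t) ^ k := by
  induction k with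
  | zero => simp [alternatingWord]
  | succ k ih =>
    rw [show 2 * (k + 1) = 2 * k + 1 + 1 by ring, alternatingWord_succ', alternatingWord_succ']
    simp only [List.map_cons, List.prod_cons, ih]
    simp [parity_simps]
    ring

theorem isConj_simple_of_odd {s t : B} (h : Odd (M s t)) :
    IsConj (cs.simple s) (cs.simple t) := by
  obtain ⟨k, hk⟩ := h
  have h1 := cs.simple_mul_simple_pow s t
  have h2 := cs.simple_mul_pow s t (k + 1)
  rw [isConj_comm, isConj_iff]
  -- When `st` has order dividing `2k+1`, its power `k+1` is a square root of `st`.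
  refine ⟨(cs.simple s * cs.simple t) ^ (k + 1), ?_⟩
  rw [mul_inv_eq_iff_eq_mul, eq_comm]
  rw [hk] at h1
  have h3 : (cs.simple s * cs.simple t) ^ (k + 1) * (cs.simple s * cs.simple t) ^ (k + 1) =
      cs.simple s * cs.simple t := by
    rw [← pow_add, show k + 1 + (k + 1) = 2 * k + 1 + 1 by ring, pow_succ, h1, one_mul]
  calc
    _ = (cs.simple s * cs.simple t) ^ (k + 1) * (cs.simple s * cs.simple t) ^ (k + 1) *
        (cs.simple t * (cs.simple s * cs.simple t) ^ (k + 1)) := by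
      rw [h3, ← mul_assoc, simple_mul_simple_cancel_right]
    _ = _ := by rw [h2]; group

/-- This makes Matsumoto's theorem applicable to the parameters: an even braid relation is symmetric
in a commutative ring, an odd one forces `s` and `t` to be conjugate. -/
theorem param_braid (ha : ∀ s t : B, IsConj (cs.simple s) (cs.simple t) → a s = a t) (s t : B) :
    ((alternatingWord s t (M s t)).map a).prod = ((alternatingWord t s (M s t)).map a).prod := by
  rcases Nat.even_or_odd (M s t) with h | h
  · obtain ⟨k, hk⟩ := h.two_dvd
    rw [hk, prod_map_alternatingWord_two_mul, prod_map_alternatingWord_two_mul, mul_comm]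
  · have := ha s t (isConj_simple_of_odd cs h)
    obtain ⟨k, hk⟩ := h
    rw [hk, alternatingWord_succ', alternatingWord_succ']
    simp [prod_map_alternatingWord_two_mul, this]

theorem weight_wordProd (ha : ∀ s t : B, IsConj (cs.simple s) (cs.simple t) → a s = a t)
    {ω : List B} (hω : cs.IsReduced ω) : weight cs a (cs.wordProd ω) = (ω.map a).prod :=
  cs.prod_map_eq_of_isReduced (param_braid cs ha) (isReduced_reducedWord cs _) hω
    (wordProd_reducedWord cs _)

theorem isReduced_reducedWord_append {w : W} {s : B}
    (h : cs.length w < cs.length (w * cs.simple s)) :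
    cs.IsReduced (reducedWord cs w ++ [s]) :=
  (isReduced_reducedWord cs w).append_simple (by rwa [wordProd_reducedWord])

theorem isReduced_cons_reducedWord {w : W} {s : B}
    (h : cs.length w < cs.length (cs.simple s * w)) :
    cs.IsReduced (s :: reducedWord cs w) := by
  have h1 := (isReduced_reducedWord cs w).eq
  rw [wordProd_reducedWord] at h1
  rw [CoxeterSystem.IsReduced, wordProd_cons, wordProd_reducedWord, List.length_cons, ← h1]
  rcases cs.length_simple_mul w s with h2 | h2
  · exact h2
  · omega

theorem T_one : T cs a 1 = 1 := by
  have : cs.IsReduced [] := by simp [CoxeterSystem.IsReduced]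
  simpa using T_wordProd cs (a := a) this

theorem weight_one (ha : ∀ s t : B, IsConj (cs.simple s) (cs.simple t) → a s = a t) :
    weight cs a 1 = 1 := by
  have : cs.IsReduced [] := by simp [CoxeterSystem.IsReduced]
  simpa using weight_wordProd cs ha this

theorem T_mul_simple {w : W} {s : B} (h : cs.length w < cs.length (w * cs.simple s)) :
    T cs a (w * cs.simple s) = T cs a w * gen M a s := by
  have := T_wordProd cs (a := a) (isReduced_reducedWord_append cs h)
  rw [wordProd_append, wordProd_singleton, wordProd_reducedWord] at this
  rw [this]
  simp [T]

theorem T_simple_mul {w : W} {s : B} (h : cs.length w < cs.length (cs.simple s * w)) :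
    T cs a (cs.simple s * w) = gen M a s * T cs a w := by
  have := T_wordProd cs (a := a) (isReduced_cons_reducedWord cs h)
  rw [wordProd_cons, wordProd_reducedWord] at this
  rw [this]
  simp [T]

theorem weight_mul_simple (ha : ∀ s t : B, IsConj (cs.simple s) (cs.simple t) → a s = a t)
    {w : W} {s : B} (h : cs.length w < cs.length (w * cs.simple s)) :
    weight cs a (w * cs.simple s) = weight cs a w * a s := by
  have := weight_wordProd cs ha (isReduced_reducedWord_append cs h)
  rw [wordProd_append, wordProd_singleton, wordProd_reducedWord] at this
  rw [this]
  simp [weight]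

theorem weight_inv (ha : ∀ s t : B, IsConj (cs.simple s) (cs.simple t) → a s = a t) (w : W) :
    weight cs a w⁻¹ = weight cs a w := by
  have := weight_wordProd cs ha (isReduced_reducedWord cs w).reverse
  rw [wordProd_reverse, wordProd_reducedWord] at this
  rw [this, List.map_reverse, List.prod_reverse]
  rfl

theorem T_mul_gen_of_descent {w : W} {s : B} (h : cs.length (w * cs.simple s) < cs.length w) :
    T cs a w * gen M a s = (a s - 1) • T cs a w + a s • T cs a (w * cs.simple s) := by
  have h1 := T_mul_simple cs (a := a) (w := w * cs.simple s) (s := s) (by simpa using h)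
  rw [simple_mul_simple_cancel_right] at h1
  rw [h1, mul_assoc, gen_mul_gen, mul_add, mul_smul_comm, mul_smul_comm, mul_one]

theorem gen_mul_T_of_descent {w : W} {s : B} (h : cs.length (cs.simple s * w) < cs.length w) :
    gen M a s * T cs a w = (a s - 1) • T cs a w + a s • T cs a (cs.simple s * w) := by
  have h1 := T_simple_mul cs (a := a) (w := cs.simple s * w) (s := s) (by simpa using h)
  rw [simple_mul_simple_cancel_left] at h1
  rw [h1, ← mul_assoc, gen_mul_gen, add_mul, smul_mul_assoc, smul_mul_assoc, one_mul]

theorem heckeAlgebra_induction {P : HeckeAlgebra M a → Prop}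
    (algebraMap : ∀ c : A, P (algebraMap A _ c)) (gen : ∀ s, P (gen M a s))
    (mul : ∀ x y, P x → P y → P (x * y)) (add : ∀ x y, P x → P y → P (x + y))
    (x : HeckeAlgebra M a) : P x := by
  obtain ⟨y, rfl⟩ := RingQuot.mkAlgHom_surjective A (Rel M a) x
  induction y using FreeAlgebra.induction with
  | grade0 c => rw [AlgHom.commutes]; exact algebraMap c
  | grade1 s => exact gen s
  | mul x y hx hy => rw [map_mul]; exact mul _ _ hx hy
  | add x y hx hy => rw [map_add]; exact add _ _ hx hy

/-- The span is stable under left multiplication by the generators, hence a left ideal, and it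
contains `1`. -/
theorem span_range_T : Submodule.span A (Set.range (T cs a)) = ⊤ := by
  set S := Submodule.span A (Set.range (T cs a)) with hS
  have hT (w : W) : T cs a w ∈ S := Submodule.subset_span ⟨w, rfl⟩
  have hgen (s : B) (x) (hx : x ∈ S) : gen M a s * x ∈ S := by
    induction hx using Submodule.span_induction with
    | mem x hx =>
      obtain ⟨w, rfl⟩ := hx
      rcases lt_or_gt_of_ne (cs.length_simple_mul_ne w s) with h | h
      · rw [gen_mul_T_of_descent cs h]
        exact S.add_mem (S.smul_mem _ (hT _)) (S.smul_mem _ (hT _))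
      · rw [← T_simple_mul cs h]
        exact hT _
    | zero => simp
    | add x y _ _ hx hy => rw [mul_add]; exact S.add_mem hx hy
    | smul c x _ hx => rw [mul_smul_comm]; exact S.smul_mem _ hx
  have hall (h : HeckeAlgebra M a) : ∀ x ∈ S, h * x ∈ S := by
    induction h using heckeAlgebra_induction with
    | algebraMap c => intro x hx; rw [← Algebra.smul_def]; exact S.smul_mem _ hx
    | gen s => exact hgen s
    | mul x y hx hy => intro z hz; rw [mul_assoc]; exact hx _ (hy _ hz)
    | add x y hx hy => intro z hz; rw [add_mul]; exact S.add_mem (hx _ hz) (hy _ hz)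
  rw [eq_top_iff]
  intro h _
  have := hall h 1 (by rw [← T_one cs]; exact hT 1)
  rwa [mul_one] at this

/-- Left multiplication by `T_s` in the regular representation. -/
noncomputable def leftOp (a : B → A) (s : B) : Module.End A (W →₀ A) :=
  Finsupp.linearCombination A fun w =>
    if cs.length w < cs.length (cs.simple s * w) then Finsupp.single (cs.simple s * w) 1
    else (a s - 1) • Finsupp.single w 1 + a s • Finsupp.single (cs.simple s * w) 1

/-- Right multiplication by `T_s` in the regular representation. -/
noncomputable def rightOp (a : B → A) (s : B) : Module.End A (W →₀ A) :=
  Finsupp.linearCombination A fun w =>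
    if cs.length w < cs.length (w * cs.simple s) then Finsupp.single (w * cs.simple s) 1
    else (a s - 1) • Finsupp.single w 1 + a s • Finsupp.single (w * cs.simple s) 1

theorem leftOp_of_lt {s : B} {w : W} (h : cs.length w < cs.length (cs.simple s * w)) :
    leftOp cs a s (Finsupp.single w 1) = Finsupp.single (cs.simple s * w) 1 := by
  rw [leftOp, Finsupp.linearCombination_single, if_pos h, one_smul]

theorem leftOp_of_gt {s : B} {w : W} (h : cs.length (cs.simple s * w) < cs.length w) :
    leftOp cs a s (Finsupp.single w 1) =
      (a s - 1) • Finsupp.single w 1 + a s • Finsupp.single (cs.simple s * w) 1 := by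
  rw [leftOp, Finsupp.linearCombination_single, if_neg h.not_gt, one_smul]

theorem rightOp_of_lt {s : B} {w : W} (h : cs.length w < cs.length (w * cs.simple s)) :
    rightOp cs a s (Finsupp.single w 1) = Finsupp.single (w * cs.simple s) 1 := by
  rw [rightOp, Finsupp.linearCombination_single, if_pos h, one_smul]

theorem rightOp_of_gt {s : B} {w : W} (h : cs.length (w * cs.simple s) < cs.length w) :
    rightOp cs a s (Finsupp.single w 1) =
      (a s - 1) • Finsupp.single w 1 + a s • Finsupp.single (w * cs.simple s) 1 := by
  rw [rightOp, Finsupp.linearCombination_single, if_neg h.not_gt, one_smul]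

theorem leftOp_mul_leftOp (s : B) :
    leftOp cs a s * leftOp cs a s = (a s - 1) • leftOp cs a s + a s • 1 := by
  refine Finsupp.lhom_ext' fun w => LinearMap.ext_ring ?_
  simp only [LinearMap.comp_apply, Finsupp.lsingle_apply, Module.End.mul_apply,
    LinearMap.add_apply, LinearMap.smul_apply, Module.End.one_apply]
  rcases lt_or_gt_of_ne (cs.length_simple_mul_ne w s) with h | h
  · have h' : cs.length (cs.simple s * w) < cs.length (cs.simple s * (cs.simple s * w)) := by
      simpa using h
    rw [leftOp_of_gt cs h, map_add, map_smul, map_smul, leftOp_of_gt cs h, leftOp_of_lt cs h']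
    simp
  · have h' : cs.length (cs.simple s * (cs.simple s * w)) < cs.length (cs.simple s * w) := by
      simpa using h
    rw [leftOp_of_lt cs h, leftOp_of_gt cs h']
    simp

theorem simple_mul_eq_mul_simple_of_gt {w : W} {s t : B}
    (hs : cs.length (cs.simple s * w) < cs.length w) (ht : cs.length (w * cs.simple t) < cs.length w)
    (hst : cs.length (cs.simple s * w * cs.simple t) = cs.length w) :
    cs.simple s * w = w * cs.simple t := by
  have h1 := cs.length_simple_mul w s
  have h2 := cs.length_mul_simple w t
  have := cs.eq_of_length_simple_mul_simple (w := cs.simple s * w) (s := s) (t := t)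
    (by simpa using hs) (by rw [hst]; exact hs) (by simp; omega)
  rw [simple_mul_simple_cancel_left] at this
  nth_rw 2 [this]
  simp

/-- Comparing lengths settles all cases directly except when `s w t` has the length of `w` while `s
w` and `w t` are both longer or both shorter. Then `s w = w t`, so `s` and `t` are conjugate and
their parameters agree. -/
theorem commute_leftOp_rightOp (ha : ∀ s t : B, IsConj (cs.simple s) (cs.simple t) → a s = a t)
    (s t : B) : Commute (leftOp cs a s) (rightOp cs a t) := by
  refine Finsupp.lhom_ext' fun w => LinearMap.ext_ring ?_
  simp only [LinearMap.comp_apply, Finsupp.lsingle_apply, Module.End.mul_apply]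
  have hconj (h : cs.simple s * w = w * cs.simple t) : a s = a t := by
    apply ha
    rw [isConj_comm, isConj_iff]
    exact ⟨w, by rw [← h, mul_inv_cancel_right]⟩
  have l1 := cs.length_simple_mul w s
  have l2 := cs.length_mul_simple w t
  have l3 := cs.length_simple_mul (w * cs.simple t) s
  have l4 := cs.length_mul_simple (cs.simple s * w) t
  rw [← mul_assoc] at l3
  by_cases h1 : cs.length w < cs.length (cs.simple s * w) <;>
  by_cases h2 : cs.length w < cs.length (w * cs.simple t)
  · rw [leftOp_of_lt cs h1, rightOp_of_lt cs h2]
    by_cases h3 : cs.length (cs.simple s * w * cs.simple t) = cs.length w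
    · have e := cs.eq_of_length_simple_mul_simple h1 h2 h3
      rw [leftOp_of_gt cs (by rw [← mul_assoc]; omega), rightOp_of_gt cs (by omega), hconj e, e,
        ← mul_assoc, e]
    · rw [leftOp_of_lt cs (by rw [← mul_assoc]; omega), rightOp_of_lt cs (by omega), mul_assoc]
  · rw [leftOp_of_lt cs h1, rightOp_of_gt cs (by omega), map_add, map_smul, map_smul,
      leftOp_of_lt cs h1, leftOp_of_lt cs (by rw [← mul_assoc]; omega),
      rightOp_of_gt cs (by omega), mul_assoc]
  · rw [leftOp_of_gt cs (by omega), rightOp_of_lt cs h2, map_add, map_smul, map_smul,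
      rightOp_of_lt cs h2, rightOp_of_lt cs (by omega),
      leftOp_of_gt cs (by rw [← mul_assoc]; omega), mul_assoc]
  · rw [leftOp_of_gt cs (by omega), rightOp_of_gt cs (by omega), map_add, map_smul, map_smul,
      map_add, map_smul, map_smul, leftOp_of_gt cs (by omega), rightOp_of_gt cs (by omega)]
    by_cases h3 : cs.length (cs.simple s * w * cs.simple t) = cs.length w
    · have e := simple_mul_eq_mul_simple_of_gt cs (s := s) (w := w) (t := t)
        (by omega) (by omega) h3
      have e' : cs.simple s * (w * cs.simple t) = w := by rw [← e]; simp
      rw [leftOp_of_lt cs (by rw [← mul_assoc]; omega), rightOp_of_lt cs (by omega), hconj e, e,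
        e', simple_mul_simple_cancel_right]
    · rw [leftOp_of_gt cs (by rw [← mul_assoc]; omega), rightOp_of_gt cs (by omega), mul_assoc]
      module

theorem prod_leftOp_single_one {ω : List B} (hω : cs.IsReduced ω) :
    (ω.map (leftOp cs a)).prod (Finsupp.single 1 1) = Finsupp.single (cs.wordProd ω) 1 := by
  induction ω with
  | nil => simp
  | cons s ω ih =>
    have hω' : cs.IsReduced ω := by simpa using hω.drop 1
    rw [List.map_cons, List.prod_cons, Module.End.mul_apply, ih hω', leftOp_of_lt, wordProd_cons]
    have := hω.eq
    rw [wordProd_cons, List.length_cons] at this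
    rw [this, hω'.eq]
    omega

/-- Every basis vector arises from the one at `1` by right operators, which commute with the left
ones. It therefore suffices to test at `1`, where both sides give the same dihedral element. -/
theorem leftOp_braid (ha : ∀ s t : B, IsConj (cs.simple s) (cs.simple t) → a s = a t) (s t : B) :
    ((alternatingWord s t (M s t)).map (leftOp cs a)).prod =
      ((alternatingWord t s (M s t)).map (leftOp cs a)).prod := by
  refine Finsupp.lhom_ext' fun w => LinearMap.ext_ring ?_
  simp only [LinearMap.comp_apply, Finsupp.lsingle_apply]
  induction hn : cs.length w using Nat.strong_induction_on generalizing w with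
  | _ n ih =>
  by_cases hw : w = 1
  · subst hw
    rw [prod_leftOp_single_one cs (cs.isReduced_alternatingWord s t (Or.inr le_rfl)),
      prod_leftOp_single_one cs (cs.isReduced_alternatingWord t s (Or.inr (M.symmetric s t).le))]
    have := cs.wordProd_braidWord_eq s t
    rw [braidWord, braidWord, M.symmetric t s] at this
    rw [this]
  · obtain ⟨i, hi⟩ := cs.exists_rightDescent_of_ne_one hw
    have hcomm (ω : List B) (x : W →₀ A) : (ω.map (leftOp cs a)).prod (rightOp cs a i x) =
        rightOp cs a i ((ω.map (leftOp cs a)).prod x) := by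
      have : Commute (ω.map (leftOp cs a)).prod (rightOp cs a i) := by
        apply Commute.list_prod_left
        intro f hf
        obtain ⟨j, -, rfl⟩ := List.mem_map.mp hf
        exact commute_leftOp_rightOp cs ha j i
      exact LinearMap.congr_fun this x
    have e : Finsupp.single w (1 : A) = rightOp cs a i (Finsupp.single (w * cs.simple i) 1) := by
      rw [rightOp_of_lt cs (by simpa [IsRightDescent] using hi), simple_mul_simple_cancel_right]
    rw [e, hcomm, hcomm, ih _ (by rw [← hn]; exact hi) _ rfl]

/-- The left regular representation in the basis `T_w`. -/
noncomputable def regularRep (ha : ∀ s t : B, IsConj (cs.simple s) (cs.simple t) → a s = a t) :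
    HeckeAlgebra M a →ₐ[A] Module.End A (W →₀ A) :=
  RingQuot.liftAlgHom A ⟨FreeAlgebra.lift A (leftOp cs a), by
    intro x y h
    induction h with
    | quadratic s =>
      rw [map_mul, map_add, map_mul, AlgHom.commutes, AlgHom.commutes, ← Algebra.smul_def,
        Algebra.algebraMap_eq_smul_one, FreeAlgebra.lift_ι_apply]
      exact leftOp_mul_leftOp cs s
    | braid s t =>
      rw [map_list_prod, map_list_prod, List.map_map, List.map_map]
      simpa [Function.comp_def] using leftOp_braid cs ha s t⟩

theorem regularRep_gen (ha : ∀ s t : B, IsConj (cs.simple s) (cs.simple t) → a s = a t) (s : B) :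
    regularRep cs ha (gen M a s) = leftOp cs a s := by
  have : regularRep cs ha (gen M a s) = FreeAlgebra.lift A (leftOp cs a) (FreeAlgebra.ι A s) :=
    RingQuot.liftAlgHom_mkAlgHom_apply _ _ _ _
  rw [this, FreeAlgebra.lift_ι_apply]

theorem regularRep_T (ha : ∀ s t : B, IsConj (cs.simple s) (cs.simple t) → a s = a t) (w : W) :
    regularRep cs ha (T cs a w) (Finsupp.single 1 1) = Finsupp.single w 1 := by
  have := prod_leftOp_single_one cs (a := a) (isReduced_reducedWord cs w)
  rw [wordProd_reducedWord] at this
  rw [T, map_list_prod, List.map_map, ← this]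
  simp [Function.comp_def, regularRep_gen]

theorem linearIndependent_T (ha : ∀ s t : B, IsConj (cs.simple s) (cs.simple t) → a s = a t) :
    LinearIndependent A (T cs a) := by
  let f : HeckeAlgebra M a →ₗ[A] (W →₀ A) :=
    (LinearMap.applyₗ (Finsupp.single (1 : W) (1 : A))).comp (regularRep cs ha).toLinearMap
  apply LinearIndependent.of_comp f
  have : f ∘ T cs a = fun w => Finsupp.single w 1 := funext (regularRep_T cs ha)
  rw [this]
  exact Finsupp.linearIndependent_single_one A W

/-- The basis `T_w` of the Iwahori-Hecke algebra. -/
noncomputable def basisT (ha : ∀ s t : B, IsConj (cs.simple s) (cs.simple t) → a s = a t) :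
    Module.Basis W A (HeckeAlgebra M a) :=
  Module.Basis.mk (linearIndependent_T cs ha) (span_range_T cs).ge

theorem basisT_apply (ha : ∀ s t : B, IsConj (cs.simple s) (cs.simple t) → a s = a t) (w : W) :
    basisT cs ha w = T cs a w :=
  Module.Basis.mk_apply _ _ _

/-- The canonical symmetrizing trace: the coefficient of `T_1`. -/
noncomputable def canonicalTrace
    (ha : ∀ s t : B, IsConj (cs.simple s) (cs.simple t) → a s = a t) :
    HeckeAlgebra M a →ₗ[A] A :=
  (basisT cs ha).coord 1

open Classical in
theorem canonicalTrace_T (ha : ∀ s t : B, IsConj (cs.simple s) (cs.simple t) → a s = a t) (w : W) :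
    canonicalTrace cs ha (T cs a w) = if w = 1 then 1 else 0 := by
  rw [← basisT_apply cs ha, canonicalTrace, Module.Basis.coord_apply, Module.Basis.repr_self,
    Finsupp.single_apply]

open Classical in
-- Induction moves the first letter `s` of `v = s x` onto `w`. If `w s` is shorter than `w`, the
-- quadratic relation adds a multiple of `T_w T_x`, of trace zero: `w = x⁻¹` would make `w s = (s
-- x)⁻¹` longer.
theorem canonicalTrace_T_mul_T
    (ha : ∀ s t : B, IsConj (cs.simple s) (cs.simple t) → a s = a t) (w v : W) :
    canonicalTrace cs ha (T cs a w * T cs a v) = if w * v = 1 then weight cs a w else 0 := by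
  induction hn : cs.length v using Nat.strong_induction_on generalizing w v with
  | _ n ih =>
  by_cases hv : v = 1
  · subst hv
    rw [T_one, mul_one, mul_one, canonicalTrace_T]
    split_ifs with h
    · rw [h, weight_one cs ha]
    · rfl
  · obtain ⟨s, hs⟩ := cs.exists_leftDescent_of_ne_one hv
    obtain ⟨x, rfl⟩ : ∃ x, v = cs.simple s * x := ⟨cs.simple s * v, by simp⟩
    rw [IsLeftDescent, simple_mul_simple_cancel_left] at hs
    have hx := ih _ (by rw [← hn]; exact hs) (w := w) (v := x) rfl
    have hx' := ih _ (by rw [← hn]; exact hs) (w := w * cs.simple s) (v := x) rfl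
    rw [T_simple_mul cs hs, ← mul_assoc, ← mul_assoc]
    rcases lt_or_gt_of_ne (cs.length_mul_simple_ne w s) with h | h
    · rw [T_mul_gen_of_descent cs h, add_mul, smul_mul_assoc, smul_mul_assoc, map_add, map_smul,
        map_smul, hx, hx']
      have h1 : w * x ≠ 1 := by
        intro h1
        obtain rfl := eq_inv_of_mul_eq_one_left h1
        rw [← cs.length_inv, mul_inv_rev, inv_inv, inv_simple, cs.length_inv] at h
        omega
      have h2 := weight_mul_simple cs ha (w := w * cs.simple s) (s := s) (by simpa using h)
      rw [simple_mul_simple_cancel_right] at h2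
      rw [if_neg h1, h2]
      split_ifs <;> simp [mul_comm]
    · rw [← T_mul_simple cs h, hx']
      have h1 : w * cs.simple s * x ≠ 1 := by
        intro h1
        have h2 : w * cs.simple s = x⁻¹ := eq_inv_of_mul_eq_one_left h1
        have h3 : w = (cs.simple s * x)⁻¹ := by rw [mul_inv_rev, ← h2]; simp
        rw [h2, h3, cs.length_inv, cs.length_inv] at h
        omega
      rw [if_neg h1, if_neg h1]

theorem canonicalTrace_mul_comm
    (ha : ∀ s t : B, IsConj (cs.simple s) (cs.simple t) → a s = a t) (x y : HeckeAlgebra M a) :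
    canonicalTrace cs ha (x * y) = canonicalTrace cs ha (y * x) := by
  classical
  have : (LinearMap.mul A _).compr₂ (canonicalTrace cs ha) =
      ((LinearMap.mul A _).compr₂ (canonicalTrace cs ha)).flip := by
    refine (basisT cs ha).ext fun w => (basisT cs ha).ext fun v => ?_
    simp only [basisT_apply, LinearMap.compr₂_apply, LinearMap.flip_apply, LinearMap.mul_apply',
      canonicalTrace_T_mul_T]
    by_cases h : w * v = 1
    · obtain rfl := eq_inv_of_mul_eq_one_left h
      simp [weight_inv cs ha]
    · have h' : ¬ v * w = 1 := fun h' => h (mul_eq_one_comm.mp h')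
      rw [if_neg h, if_neg h']
  exact LinearMap.congr_fun₂ this x y

end Basis

end IwahoriHecke

open MulOpposite

/-! ### Symmetric algebras and dual bases -/

section SymmetricAlgebra

variable {K H ι : Type*} [Field K] [Ring H] [Algebra K H] [Fintype ι]

open Classical in
/-- A basis `b` of a symmetric algebra with symmetrizing trace `τ`, together with the basis `b'`
which is dual to it for the trace form. -/
structure IsSymmetrizing (b : Module.Basis ι K H) (b' : ι → H) (τ : H →ₗ[K] K) : Prop where
  comm (x y : H) : τ (x * y) = τ (y * x)
  dual (i j : ι) : τ (b' i * b j) = if i = j then 1 else 0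

namespace IsSymmetrizing

variable {b : Module.Basis ι K H} {b' : ι → H} {τ : H →ₗ[K] K} (hb : IsSymmetrizing b b' τ)

include hb

theorem repr_eq (h : H) (i : ι) : b.repr h i = τ (b' i * h) := by
  classical
  conv_rhs => rw [← b.sum_repr h, Finset.mul_sum, map_sum]
  simp only [mul_smul_comm, map_smul, hb.dual]
  simp

theorem sum_basis (h : H) : ∑ i, τ (b' i * h) • b i = h := by
  conv_rhs => rw [← b.sum_repr h]
  simp [hb.repr_eq]

theorem sum_dual (h : H) : ∑ i, τ (h * b i) • b' i = h := by
  set h' := ∑ i, τ (h * b i) • b' i with hh'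
  have h1 (j : ι) : τ (h' * b j) = τ (h * b j) := by
    classical
    simp [hh', Finset.sum_mul, hb.dual]
  have h2 (x : H) : τ (h' * x) = τ (h * x) := by
    rw [← hb.sum_basis x]
    simp [Finset.mul_sum, h1]
  apply b.repr.injective
  ext i
  rw [hb.repr_eq, hb.repr_eq, hb.comm, h2, hb.comm]

variable {N : Type*} [AddCommGroup N] [Module K N]

/-- The Casimir identity `∑ h b_i ⊗ b'_i = ∑ b_i ⊗ b'_i h`, tested against bilinear maps: both sides
expand with the matrix `τ(b'_j h b_i)`. -/
theorem sum_mul_left (β : H →ₗ[K] H →ₗ[K] N) (h : H) :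
    ∑ i, β (h * b i) (b' i) = ∑ i, β (b i) (b' i * h) := by
  have h1 (i : ι) : β (h * b i) (b' i) = ∑ j, τ (b' j * h * b i) • β (b j) (b' i) := by
    conv_lhs => rw [← hb.sum_basis (h * b i)]
    simp [mul_assoc]
  have h2 (j : ι) : β (b j) (b' j * h) = ∑ i, τ (b' j * h * b i) • β (b j) (b' i) := by
    conv_lhs => rw [← hb.sum_dual (b' j * h)]
    simp
  simp_rw [h1, h2]
  exact Finset.sum_comm

theorem sum_mul_right (β : H →ₗ[K] H →ₗ[K] N) (h : H) :
    ∑ i, β (b i * h) (b' i) = ∑ i, β (b i) (h * b' i) := by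
  have h1 (i : ι) : β (b i * h) (b' i) = ∑ j, τ (h * b' j * b i) • β (b j) (b' i) := by
    conv_lhs => rw [← hb.sum_basis (b i * h)]
    simp only [map_sum, map_smul, LinearMap.sum_apply, LinearMap.smul_apply]
    refine Finset.sum_congr rfl fun j _ => ?_
    rw [← mul_assoc, hb.comm, mul_assoc]
  have h2 (j : ι) : β (b j) (h * b' j) = ∑ i, τ (h * b' j * b i) • β (b j) (b' i) := by
    conv_lhs => rw [← hb.sum_dual (h * b' j)]
    simp
  simp_rw [h1, h2]
  exact Finset.sum_comm

theorem trace_sum_smul_dual (f : H →ₗ[K] K) (h : H) : τ ((∑ i, f (b i) • b' i) * h) = f h := by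
  conv_rhs => rw [← hb.sum_basis h]
  simp [Finset.sum_mul, mul_comm]

/-- For a trace function `f` the two Casimir identities join into centrality of the element
representing `f`. -/
theorem commute_sum_smul_dual {f : H →ₗ[K] K} (hf : ∀ x y, f (x * y) = f (y * x)) (h : H) :
    Commute (∑ i, f (b i) • b' i) h := by
  let β : H →ₗ[K] H →ₗ[K] H := (LinearMap.lsmul K H).comp f
  have h1 := hb.sum_mul_left β h
  have h2 := hb.sum_mul_right β h
  simp only [β, LinearMap.comp_apply, LinearMap.lsmul_apply] at h1 h2
  simp only [hf h] at h1
  rw [Commute, SemiconjBy, Finset.sum_mul, Finset.mul_sum]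
  simp only [smul_mul_assoc, mul_smul_comm]
  rw [← h1, h2]

end IsSymmetrizing

/-! ### Averaging linear maps, Schur elements and the action of character elements -/

section Average

variable {V V' : Type*} [AddCommGroup V] [Module K V] [Module Hᵐᵒᵖ V] [IsScalarTower K Hᵐᵒᵖ V]
  [AddCommGroup V'] [Module K V'] [Module Hᵐᵒᵖ V'] [IsScalarTower K Hᵐᵒᵖ V']

/-- The bilinear map `(x, y) ↦ φ(v x) y`. -/
noncomputable def sandwich (φ : V →ₗ[K] V') (v : V) : H →ₗ[K] H →ₗ[K] V' :=
  LinearMap.mk₂ K (fun x y => op y • φ (op x • v))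
    (by intros; simp [add_smul])
    (by intro c x y; rw [op_smul, smul_assoc, map_smul, smul_comm])
    (by intros; simp [add_smul])
    (by intro c x y; rw [op_smul, smul_assoc])

theorem sandwich_apply (φ : V →ₗ[K] V') (v : V) (x y : H) :
    sandwich φ v x y = op y • φ (op x • v) := rfl

variable {b : Module.Basis ι K H} {b' : ι → H} {τ : H →ₗ[K] K} (hb : IsSymmetrizing b b' τ)

/-- The average `v ↦ ∑ φ(v b_i) b'_i` of a linear map, which is a module homomorphism. -/
noncomputable def IsSymmetrizing.average (φ : V →ₗ[K] V') : V →ₗ[Hᵐᵒᵖ] V' where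
  toFun v := ∑ i, op (b' i) • φ (op (b i) • v)
  map_add' v w := by simp [Finset.sum_add_distrib]
  map_smul' h v := by
    have := hb.sum_mul_left (sandwich φ v) (unop h)
    simp only [sandwich_apply, op_mul, op_unop, mul_smul] at this
    rw [RingHom.id_apply, Finset.smul_sum]
    exact this

theorem IsSymmetrizing.average_apply (φ : V →ₗ[K] V') (v : V) :
    hb.average φ v = ∑ i, op (b' i) • φ (op (b i) • v) := rfl

theorem IsSymmetrizing.average_comp_lsmul (φ : V →ₗ[K] V') (h : Hᵐᵒᵖ) (v : V) :
    hb.average (φ ∘ₗ Algebra.lsmul K K V h) v = hb.average (Algebra.lsmul K K V' h ∘ₗ φ) v := by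
  have := hb.sum_mul_right (sandwich φ v) (unop h)
  simp only [sandwich_apply, op_mul, op_unop, mul_smul] at this
  simpa [IsSymmetrizing.average_apply] using this

theorem trace_eq_sum_coord {κ : Type*} [Fintype κ] (e : Module.Basis κ K V) (φ : V →ₗ[K] V) :
    LinearMap.trace K V φ = ∑ k, e.coord k (φ (e k)) := by
  classical
  rw [LinearMap.trace_eq_matrix_trace K e, Matrix.trace]
  simp [LinearMap.toMatrix_apply]

theorem eq_sum_smulRight {κ : Type*} [Fintype κ] (e : Module.Basis κ K V) (φ : V →ₗ[K] V') :
    φ = ∑ k, (e.coord k).smulRight (φ (e k)) := by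
  classical
  refine e.ext fun j => ?_
  simp [Finsupp.single_apply]

include hb in
/-- Existence of the Schur element of a split simple module. -/
theorem IsSymmetrizing.exists_schurElement [FiniteDimensional K V] [Nontrivial V]
    (hsplit : ∀ φ : V →ₗ[Hᵐᵒᵖ] V, ∃ k : K, ∀ x, φ x = k • x) :
    ∃ c : K, ∀ (φ : V →ₗ[K] V) (v : V), ∑ i, op (b' i) • φ (op (b i) • v) =
      (c * LinearMap.trace K V φ) • v := by
  obtain ⟨v₀, hv₀⟩ := exists_ne (0 : V)
  obtain ⟨f₀, hf₀⟩ := Module.Projective.exists_dual_eq_one K hv₀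
  let l : (V →ₗ[K] V) →ₗ[K] K :=
    { toFun := fun φ => f₀ (hb.average φ v₀)
      map_add' := by
        intro φ ψ
        simp [IsSymmetrizing.average_apply, Finset.sum_add_distrib]
      map_smul' := by
        intro c φ
        simp only [IsSymmetrizing.average_apply, LinearMap.smul_apply, RingHom.id_apply,
          smul_comm _ c, ← Finset.smul_sum, map_smul] }
  have hl (φ : V →ₗ[K] V) : l φ = f₀ (hb.average φ v₀) := rfl
  have havg (φ : V →ₗ[K] V) (v : V) : hb.average φ v = l φ • v := by
    obtain ⟨k, hk⟩ := hsplit (hb.average φ)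
    rw [hl, hk, hk, map_smul, hf₀, smul_eq_mul, mul_one]
  -- On rank-one maps `l` is a bilinear form on `V` and its dual, represented by an endomorphism
  -- `a`. Since `l(φ h) = l(h φ)`, `a` is a module map and hence a scalar `c`, which gives `l = c
  -- tr`.
  let g : V →ₗ[K] Module.Dual K (Module.Dual K V) :=
    LinearMap.mk₂ K (fun v f => l (f.smulRight v))
      (by intro v w f; rw [← map_add]; congr 1; ext; simp)
      (by intro c v f; rw [← map_smul]; congr 1; ext; exact smul_comm _ _ _)
      (by intro v f f'; rw [← map_add]; congr 1; ext; simp [add_smul])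
      (by intro c v f; rw [← map_smul]; congr 1; ext; simp [mul_smul])
  let a : V →ₗ[K] V := (Module.evalEquiv K V).symm.toLinearMap ∘ₗ g
  have ha (f : Module.Dual K V) (v : V) : f (a v) = l (f.smulRight v) := by
    simp [a, g]
  have hlin (h : Hᵐᵒᵖ) (v : V) : a (h • v) = h • a v := by
    rw [← sub_eq_zero, ← Module.forall_dual_apply_eq_zero_iff K]
    intro f
    have h1 : f.smulRight (h • v) = Algebra.lsmul K K V h ∘ₗ f.smulRight v := by
      ext x
      exact smul_comm _ _ _
    have h2 : (f ∘ₗ Algebra.lsmul K K V h).smulRight v = f.smulRight v ∘ₗ Algebra.lsmul K K V h := by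
      ext x
      simp
    have h3 : f (h • a v) = (f ∘ₗ Algebra.lsmul K K V h) (a v) := by simp
    rw [map_sub, ha, h3, ha, h1, h2, hl, hl, hb.average_comp_lsmul, sub_self]
  obtain ⟨c, hc⟩ := hsplit { toFun := a, map_add' := map_add a, map_smul' := hlin }
  refine ⟨c, fun φ v => ?_⟩
  have hlφ : l φ = c * LinearMap.trace K V φ := by
    let e := Module.finBasis K V
    conv_lhs => rw [eq_sum_smulRight e φ]
    rw [map_sum, trace_eq_sum_coord e, Finset.mul_sum]
    refine Finset.sum_congr rfl fun k _ => ?_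
    rw [← ha]
    have : a (φ (e k)) = c • φ (e k) := hc _
    rw [this, map_smul, smul_eq_mul]
  rw [← IsSymmetrizing.average_apply hb, havg, hlφ]

/-- Expanding the trace in a basis turns the action of the character element into a sum of averages
of rank-one maps, to which Schur's lemma applies. -/
theorem sum_character_smul_dual [FiniteDimensional K V] (v' : V') {κ : Type*} [Fintype κ]
    (e : Module.Basis κ K V) :
    op (∑ i, IwahoriHecke.character K V (b i) • b' i) • v' =
      ∑ k, ∑ i, op (b' i) • ((e.coord k).smulRight v') (op (b i) • e k) := by
  rw [Finset.sum_comm, Finset.op_sum, Finset.sum_smul]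
  refine Finset.sum_congr rfl fun i _ => ?_
  rw [IwahoriHecke.character, trace_eq_sum_coord e, op_smul, smul_assoc, Finset.sum_smul]
  refine Finset.sum_congr rfl fun k _ => ?_
  rw [LinearMap.smulRight_apply, smul_comm]
  rfl

theorem sum_character_smul_dual_of_schurElement [FiniteDimensional K V] {c : K}
    (hc : ∀ (φ : V →ₗ[K] V) (v : V), ∑ i, op (b' i) • φ (op (b i) • v) =
      (c * LinearMap.trace K V φ) • v) (v : V) :
    op (∑ i, IwahoriHecke.character K V (b i) • b' i) • v = c • v := by
  let e := Module.finBasis K V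
  rw [sum_character_smul_dual v e]
  simp only [hc, LinearMap.trace_smulRight, mul_smul]
  rw [← Finset.smul_sum]
  congr 1
  exact e.sum_repr v

include hb in
theorem IsSymmetrizing.sum_character_smul_dual_of_hom_eq_zero [FiniteDimensional K V]
    (hV : ∀ φ : V →ₗ[Hᵐᵒᵖ] V', φ = 0) (v : V') :
    op (∑ i, IwahoriHecke.character K V (b i) • b' i) • v = 0 := by
  rw [sum_character_smul_dual v (Module.finBasis K V)]
  refine Finset.sum_eq_zero fun k _ => ?_
  rw [← IsSymmetrizing.average_apply hb, hV (hb.average _)]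
  rfl

end Average

end SymmetricAlgebra

section Character

variable (K : Type*) {H : Type*} [Field K] [Ring H] [Algebra K H]
  (V : Type*) [AddCommGroup V] [Module K V] [Module Hᵐᵒᵖ V] [IsScalarTower K Hᵐᵒᵖ V]

/-- The character of a right module as a linear form. -/
noncomputable def characterLinear : H →ₗ[K] K where
  toFun := IwahoriHecke.character K V
  map_add' x y := by simp [IwahoriHecke.character]
  map_smul' c x := by simp [IwahoriHecke.character]

theorem characterLinear_apply (h : H) :
    characterLinear K V h = IwahoriHecke.character K V h := rfl

theorem character_mul_comm (x y : H) :
    IwahoriHecke.character K V (x * y) = IwahoriHecke.character K V (y * x) := by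
  rw [IwahoriHecke.character, IwahoriHecke.character, op_mul, op_mul, map_mul (Algebra.lsmul K K V),
    map_mul (Algebra.lsmul K K V)]
  exact LinearMap.trace_mul_comm K _ _

end Character

/-! ### Components of an idempotent along a direct decomposition -/

section Decomposition

variable {H : Type*} [Ring H] {e : H} {r : ℕ} {V : Fin r → Submodule Hᵐᵒᵖ H}

theorem mul_mem_of_mem_left {X : Submodule Hᵐᵒᵖ H} {x : H} (hx : x ∈ X) (h : H) : x * h ∈ X :=
  X.smul_mem (op h) hx

theorem mul_eq_self_of_mem_span (he : e * e = e) {y : H}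
    (hy : y ∈ Submodule.span Hᵐᵒᵖ {e}) : e * y = y := by
  obtain ⟨h, rfl⟩ := Submodule.mem_span_singleton.mp hy
  change e * (e * unop h) = e * unop h
  rw [← mul_assoc, he]

theorem iSupIndep.eq_of_sum_eq (hV : iSupIndep V) {x y : Fin r → H} (hx : ∀ i, x i ∈ V i)
    (hy : ∀ i, y i ∈ V i) (h : ∑ i, x i = ∑ i, y i) : x = y :=
  funext fun i => (iSupIndep_iff_finsetSum_eq_imp_eq V).mp hV Finset.univ x y
    (fun i _ => ⟨hx i, hy i⟩) h i (Finset.mem_univ i)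

theorem exists_component (hsup : ⨆ i, V i = Submodule.span Hᵐᵒᵖ {e}) :
    ∃ x : Fin r → H, (∀ i, x i ∈ V i) ∧ ∑ i, x i = e := by
  have : e ∈ ⨆ i, V i := hsup ▸ Submodule.mem_span_singleton_self e
  obtain ⟨f, hf, hs⟩ := (Submodule.mem_iSup_iff_exists_finsupp V e).mp this
  exact ⟨f, hf, by rw [← hs, Finsupp.sum_fintype]; simp⟩

variable (he : e * e = e) (hV : iSupIndep V) (hsup : ⨆ i, V i = Submodule.span Hᵐᵒᵖ {e})
  {x : Fin r → H} (hx : ∀ i, x i ∈ V i) (hxe : ∑ i, x i = e)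

include he hV hsup hx hxe

theorem component_mul {i : Fin r} {y : H} (hy : y ∈ V i) (j : Fin r) :
    x j * y = if j = i then y else 0 := by
  have hey : e * y = y := mul_eq_self_of_mem_span he (hsup ▸ Submodule.mem_iSup_of_mem i hy)
  have := hV.eq_of_sum_eq (x := fun j => x j * y) (y := fun j => if j = i then y else 0)
    (fun j => mul_mem_of_mem_left (hx j) y)
    (fun j => by
      split_ifs with h
      · rwa [h]
      · exact (V j).zero_mem)
    (by rw [← Finset.sum_mul, hxe, hey]; simp)
  exact congrFun this j

theorem component_mul_idempotent (i : Fin r) : x i * e = x i := by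
  rw [← hxe, Finset.mul_sum]
  simp only [component_mul he hV hsup hx hxe (hx _)]
  simp

theorem component_ne_zero (hsimple : ∀ i, IsSimpleModule Hᵐᵒᵖ (V i)) (i : Fin r) : x i ≠ 0 := by
  intro h
  have := IsSimpleModule.nontrivial Hᵐᵒᵖ (V i)
  obtain ⟨y, hy⟩ := exists_ne (0 : V i)
  apply hy
  have := component_mul he hV hsup hx hxe y.2 i
  rw [h, zero_mul, if_pos rfl] at this
  exact Subtype.ext this.symm

end Decomposition

/-! ### Multiplicity-free modules -/

section MultiplicityFree

variable {R N : Type*} [Ring R] [AddCommGroup N] [Module R N]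

theorem IwahoriHecke.IsMultiplicityFree.hom_eq_zero {P : Submodule R N}
    (hP : IwahoriHecke.IsMultiplicityFree R P) {X Y : Submodule R N} (hX : X ≤ P) (hY : Y ≤ P)
    [hXs : IsSimpleModule R X] [hYs : IsSimpleModule R Y] (hne : X ≠ Y) (φ : X →ₗ[R] Y) :
    φ = 0 := by
  rcases φ.bijective_or_eq_zero with h | h
  · exfalso
    apply hne
    let eX := Submodule.submoduleOfEquivOfLe hX
    let eY := Submodule.submoduleOfEquivOfLe hY
    have h1 := hP (X.submoduleOf P) (Y.submoduleOf P)
      (IsSimpleModule.congr eX) (IsSimpleModule.congr eY)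
      ⟨(eX.trans (LinearEquiv.ofBijective φ h)).trans eY.symm⟩
    have h2 := congrArg (Submodule.map P.subtype) h1
    rwa [Submodule.submoduleOf, Submodule.submoduleOf, Submodule.map_comap_subtype,
      Submodule.map_comap_subtype, inf_eq_right.mpr hX, inf_eq_right.mpr hY] at h2
  · exact h

theorem iSupIndep.injective_of_isSimpleModule {ι : Type*} {V : ι → Submodule R N}
    (hV : iSupIndep V) (hs : ∀ i, IsSimpleModule R (V i)) : Function.Injective V := by
  apply hV.injective
  intro i h
  have := IsSimpleModule.nontrivial R (V i)
  exact (Submodule.nontrivial_iff_ne_bot.mp this) h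

end MultiplicityFree

/-! ### Zonal spherical elements in a split symmetric algebra -/

section Spherical

variable {K H ι : Type*} [Field K] [Ring H] [Algebra K H] [Fintype ι]
  {b : Module.Basis ι K H} {b' : ι → H} {τ : H →ₗ[K] K} (hb : IsSymmetrizing b b' τ)
  {e : H} {r : ℕ} {V : Fin r → Submodule Hᵐᵒᵖ H}

theorem Submodule.finite_of_mulOpposite [Module.Finite K H] (X : Submodule Hᵐᵒᵖ H) :
    Module.Finite K X :=
  Module.Finite.of_injective (X.subtype.restrictScalars K) X.injective_subtype

theorem IwahoriHecke.SimplesSplit.exists_smul (hs : IwahoriHecke.SimplesSplit K H)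
    (X : Submodule Hᵐᵒᵖ H) [hX : IsSimpleModule Hᵐᵒᵖ X] (φ : X →ₗ[Hᵐᵒᵖ] X) :
    ∃ k : K, ∀ x, φ x = k • x := by
  obtain ⟨k, hk⟩ := hs X hX φ
  refine ⟨k, fun x => ?_⟩
  rw [hk, ← algebraMap_smul Hᵐᵒᵖ k x]
  rfl

include hb in
-- By centrality the character element may be moved to the right of `e = ∑ x_j`, where it acts on
-- `x_i` by `c` and annihilates the other components.
theorem IsSymmetrizing.sum_character_mul_eq_smul_component [Module.Finite K H]
    (hhom : ∀ i j, i ≠ j → ∀ φ : V i →ₗ[Hᵐᵒᵖ] V j, φ = 0)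
    {x : Fin r → H} (hx : ∀ i, x i ∈ V i) (hxe : ∑ i, x i = e) {i : Fin r} {c : K}
    (hc : ∀ (φ : V i →ₗ[K] V i) (v : V i), ∑ k, op (b' k) • φ (op (b k) • v) =
      (c * LinearMap.trace K (V i) φ) • v) :
    (∑ k, IwahoriHecke.character K (V i) (b k) • b' k) * e = c • x i := by
  have hfin := fun j => Submodule.finite_of_mulOpposite (K := K) (V j)
  have hz := hb.commute_sum_smul_dual (f := characterLinear K (V i)) (character_mul_comm K (V i)) e
  simp only [characterLinear_apply] at hz
  set z := ∑ k, IwahoriHecke.character K (V i) (b k) • b' k with hzdef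
  have hxz (j : Fin r) : x j * z = if j = i then c • x j else 0 := by
    split_ifs with h
    · subst h
      exact congrArg Subtype.val (sum_character_smul_dual_of_schurElement hc ⟨x j, hx j⟩)
    · exact congrArg Subtype.val (hb.sum_character_smul_dual_of_hom_eq_zero
        (hhom i j (Ne.symm h)) ⟨x j, hx j⟩)
  rw [hz.eq, ← hxe, Finset.sum_mul]
  simp [hxz]

section Component

variable (hs : IwahoriHecke.SimplesSplit K H) (he : e * e = e) (hV : iSupIndep V)
  (hsup : ⨆ i, V i = Submodule.span Hᵐᵒᵖ {e}) (hsimple : ∀ i, IsSimpleModule Hᵐᵒᵖ (V i))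
  (hhom : ∀ i j, i ≠ j → ∀ φ : V i →ₗ[Hᵐᵒᵖ] V j, φ = 0)
  {x : Fin r → H} (hx : ∀ i, x i ∈ V i) (hxe : ∑ i, x i = e)

include hs hsimple hhom hx hxe

theorem exists_mul_eq_smul_component {i : Fin r} {y : H} (hy : y ∈ V i) :
    ∃ k : K, y * e = k • x i := by
  have hsi := hsimple i
  let L (j : Fin r) : V j →ₗ[Hᵐᵒᵖ] V i :=
    { toFun := fun z => ⟨y * z, mul_mem_of_mem_left hy z⟩
      map_add' := fun z w => Subtype.ext (mul_add y z w)
      map_smul' := fun h z => Subtype.ext (mul_assoc y z (unop h)).symm }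
  obtain ⟨k, hk⟩ := hs.exists_smul (V i) (L i)
  refine ⟨k, ?_⟩
  have h1 (j : Fin r) : y * x j = if j = i then k • x j else 0 := by
    split_ifs with h
    · subst h
      exact congrArg Subtype.val (hk ⟨x j, hx j⟩)
    · exact congrArg Subtype.val (LinearMap.congr_fun (hhom j i h (L j)) ⟨x j, hx j⟩)
  rw [← hxe, Finset.mul_sum]
  simp [h1]

include he hV hsup

/-- On `V i` the idempotent acts as a rank-one map with image spanned by `x i`, and it fixes `x i`.
-/
theorem character_idempotent_eq_one [Module.Finite K H] (i : Fin r) :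
    IwahoriHecke.character K (V i) e = 1 := by
  have hfin := fun j => Submodule.finite_of_mulOpposite (K := K) (V j)
  have h0 : (⟨x i, hx i⟩ : V i) ≠ 0 := fun h =>
    component_ne_zero he hV hsup hx hxe hsimple i (congrArg Subtype.val h)
  obtain ⟨g, hg⟩ := Module.Projective.exists_dual_eq_one K h0
  have h1 : Algebra.lsmul K K (V i) (op e) =
      (g ∘ₗ Algebra.lsmul K K (V i) (op e)).smulRight ⟨x i, hx i⟩ := by
    ext1 y
    obtain ⟨k, hk⟩ := exists_mul_eq_smul_component hs hsimple hhom hx hxe y.2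
    have hk' : op e • y = k • (⟨x i, hx i⟩ : V i) := Subtype.ext hk
    change op e • y = g (op e • y) • _
    rw [hk', map_smul, hg, smul_eq_mul, mul_one]
  have h2 : op e • (⟨x i, hx i⟩ : V i) = ⟨x i, hx i⟩ :=
    Subtype.ext (component_mul_idempotent he hV hsup hx hxe i)
  rw [IwahoriHecke.character, h1, LinearMap.trace_smulRight]
  simp [h2, hg]

omit hs hhom in
theorem linearIndependent_component : LinearIndependent K x := by
  rw [Fintype.linearIndependent_iff]
  intro g hg i
  have h1 := hV.eq_of_sum_eq (x := fun i => g i • x i) (y := fun _ => 0)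
    (fun i => by
      -- `V i` is a submodule for right multiplication only, so the scalar is written as a right
      -- factor.
      rw [← mul_one (x i), ← mul_smul_comm]
      exact mul_mem_of_mem_left (hx i) _) (fun i => (V i).zero_mem)
    (by rw [hg]; simp)
  exact (smul_eq_zero.mp (congrFun h1 i)).resolve_right
    (component_ne_zero he hV hsup hx hxe hsimple i)

theorem range_mulLeftRight_eq_span_component :
    LinearMap.range (LinearMap.mulLeftRight K (e, e)) = Submodule.span K (Set.range x) := by
  apply le_antisymm
  · rintro _ ⟨h, rfl⟩
    rw [LinearMap.mulLeftRight_apply]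
    have : e * h * e = ∑ i, x i * h * e := by
      rw [← Finset.sum_mul, ← Finset.sum_mul, hxe]
    rw [this]
    refine Submodule.sum_mem _ fun i _ => ?_
    obtain ⟨k, hk⟩ := exists_mul_eq_smul_component hs hsimple hhom hx hxe
      (mul_mem_of_mem_left (hx i) h)
    rw [hk]
    exact Submodule.smul_mem _ _ (Submodule.subset_span ⟨i, rfl⟩)
  · rw [Submodule.span_le]
    rintro _ ⟨i, rfl⟩
    refine ⟨x i, ?_⟩
    rw [LinearMap.mulLeftRight_apply]
    rw [mul_eq_self_of_mem_span he (hsup ▸ Submodule.mem_iSup_of_mem i (hx i)),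
      component_mul_idempotent he hV hsup hx hxe]

end Component

end Spherical

namespace IwahoriHecke

open CoxeterSystem

/-! ### The Hecke algebra as a symmetric algebra and the idempotent of a parabolic subgroup -/

section Idempotent

variable {B W : Type*} [Group W] {M : CoxeterMatrix B} (cs : CoxeterSystem M W)
  {K : Type*} [Field K] {a : B → K}

theorem simple_mem_parabolic {J : Set B} {s : B} (hs : s ∈ J) : cs.simple s ∈ parabolic cs J :=
  Subgroup.subset_closure ⟨s, hs, rfl⟩

theorem T_add_T_mul_gen (w : W) (s : B) :
    (T cs a w + T cs a (w * cs.simple s)) * gen M a s =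
      a s • (T cs a w + T cs a (w * cs.simple s)) := by
  have key {w : W} (h : cs.length w < cs.length (w * cs.simple s)) :
      (T cs a w + T cs a (w * cs.simple s)) * gen M a s =
        a s • (T cs a w + T cs a (w * cs.simple s)) := by
    rw [add_mul, ← T_mul_simple cs h, T_mul_gen_of_descent cs (by simpa using h),
      simple_mul_simple_cancel_right]
    module
  rcases lt_or_gt_of_ne (cs.length_mul_simple_ne w s) with h | h
  · have := key (w := w * cs.simple s) (by simpa using h)
    rwa [simple_mul_simple_cancel_right, add_comm] at this
  · exact key h

theorem weight_ne_zero (ha0 : ∀ s, a s ≠ 0) (w : W) : weight cs a w ≠ 0 := by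
  rw [weight, Ne, List.prod_eq_zero_iff]
  simpa using fun s _ => ha0 s

theorem isSymmetrizing_TDual
    (ha : ∀ s t : B, IsConj (cs.simple s) (cs.simple t) → a s = a t) (ha0 : ∀ s, a s ≠ 0) :
    IsSymmetrizing (basisT cs ha) (TDual cs a) (canonicalTrace cs ha) where
  comm := canonicalTrace_mul_comm cs ha
  dual w v := by
    rw [TDual, smul_mul_assoc, map_smul, basisT_apply, canonicalTrace_T_mul_T, weight_inv cs ha,
      smul_eq_mul]
    by_cases h : w = v
    · simp [h, weight_ne_zero cs ha0]
    · have : w⁻¹ * v ≠ 1 := fun h' => h (inv_mul_eq_one.mp h')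
      simp [h, this]

variable [Fintype W]

open Classical in
/-- The sum of the basis elements `T_w` with `w ∈ W_J`. -/
noncomputable def parabolicSum (a : B → K) (J : Set B) : HeckeAlgebra M a :=
  ∑ w ∈ Finset.univ.filter (fun w : W => w ∈ parabolic cs J), T cs a w

theorem eJ_eq (J : Set B) : eJ cs a J = (poincare cs a J)⁻¹ • parabolicSum cs a J := rfl

/-- Summing the eigenvectors `T_w + T_{ws}` over `W_J` counts each basis element twice; the factor
two is then cancelled. -/
theorem parabolicSum_mul_gen [CharZero K] {J : Set B} {s : B} (hs : s ∈ J) :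
    parabolicSum cs a J * gen M a s = a s • parabolicSum cs a J := by
  classical
  have h1 : ∑ w ∈ Finset.univ.filter (fun w : W => w ∈ parabolic cs J),
      T cs a (w * cs.simple s) = parabolicSum cs a J := by
    refine Finset.sum_bij' (fun w _ => w * cs.simple s) (fun w _ => w * cs.simple s) ?_ ?_ ?_ ?_ ?_
    · intro w hw
      simpa [Subgroup.mul_mem_cancel_right _ (simple_mem_parabolic cs hs)] using hw
    · intro w hw
      simpa [Subgroup.mul_mem_cancel_right _ (simple_mem_parabolic cs hs)] using hw
    · simp
    · simp
    · simp
  have h2 : ∑ w ∈ Finset.univ.filter (fun w : W => w ∈ parabolic cs J),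
      (T cs a w + T cs a (w * cs.simple s)) = (2 : K) • parabolicSum cs a J := by
    rw [Finset.sum_add_distrib, h1, two_smul]
    rfl
  have h3 : (∑ w ∈ Finset.univ.filter (fun w : W => w ∈ parabolic cs J),
      (T cs a w + T cs a (w * cs.simple s))) * gen M a s =
      a s • ∑ w ∈ Finset.univ.filter (fun w : W => w ∈ parabolic cs J),
        (T cs a w + T cs a (w * cs.simple s)) := by
    rw [Finset.sum_mul, Finset.smul_sum]
    exact Finset.sum_congr rfl fun w _ => T_add_T_mul_gen cs w s
  rw [h2, smul_mul_assoc, smul_comm] at h3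
  exact smul_right_injective _ (two_ne_zero (α := K)) h3

/-- Induction over products of simple reflections in `J`, allowing the length to rise or fall,
avoids having to know that elements of `W_J` have reduced words with letters in `J`. -/
theorem parabolicSum_mul_T [CharZero K]
    (ha : ∀ s t : B, IsConj (cs.simple s) (cs.simple t) → a s = a t) (ha0 : ∀ s, a s ≠ 0)
    {J : Set B} {w : W} (hw : w ∈ parabolic cs J) :
    parabolicSum cs a J * T cs a w = weight cs a w • parabolicSum cs a J := by
  have step {w : W} {s : B} (hs : s ∈ J)
      (ih : parabolicSum cs a J * T cs a w = weight cs a w • parabolicSum cs a J) :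
      parabolicSum cs a J * T cs a (w * cs.simple s) =
        weight cs a (w * cs.simple s) • parabolicSum cs a J := by
    rcases lt_or_gt_of_ne (cs.length_mul_simple_ne w s) with h | h
    · have h1 := T_mul_gen_of_descent cs (a := a) h
      have h2 := weight_mul_simple cs ha (w := w * cs.simple s) (s := s) (by simpa using h)
      rw [simple_mul_simple_cancel_right] at h2
      have h3 := congrArg (parabolicSum cs a J * ·) h1
      simp only [← mul_assoc, ih, mul_add, mul_smul_comm, smul_mul_assoc,
        parabolicSum_mul_gen cs hs, h2] at h3
      -- In the descending case the quadratic relation yields `T_{ws}` only up to the factor `a s`,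
      -- which is nonzero.
      apply smul_right_injective _ (ha0 s)
      dsimp only
      rw [← sub_eq_zero] at h3 ⊢
      rw [← neg_eq_zero, ← h3]
      module
    · rw [T_mul_simple cs h, ← mul_assoc, ih, smul_mul_assoc, parabolicSum_mul_gen cs hs,
        weight_mul_simple cs ha h, smul_smul]
  rw [parabolic] at hw
  induction hw using Subgroup.closure_induction_right with
  | one => rw [T_one, weight_one cs ha, mul_one, one_smul]
  | mul_right w y _ hy ih =>
    obtain ⟨s, hs, rfl⟩ := hy
    exact step hs ih
  | mul_inv_cancel w y _ hy ih =>
    obtain ⟨s, hs, rfl⟩ := hy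
    rw [inv_simple]
    exact step hs ih

theorem eJ_mul_eJ [CharZero K]
    (ha : ∀ s t : B, IsConj (cs.simple s) (cs.simple t) → a s = a t) (ha0 : ∀ s, a s ≠ 0)
    {J : Set B} (hP : poincare cs a J ≠ 0) : eJ cs a J * eJ cs a J = eJ cs a J := by
  classical
  have h : parabolicSum cs a J * parabolicSum cs a J =
      poincare cs a J • parabolicSum cs a J := by
    conv_lhs => rw [parabolicSum, ← parabolicSum, parabolicSum, Finset.mul_sum]
    rw [poincare, Finset.sum_smul]
    refine Finset.sum_congr rfl fun w hw => ?_
    exact parabolicSum_mul_T cs ha ha0 (Finset.mem_filter.mp hw).2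
  rw [eJ_eq, smul_mul_smul_comm, h, smul_smul, mul_assoc, inv_mul_cancel₀ hP, mul_one]

end Idempotent

/-! ### Generic parameters -/

section Generic

variable {B σ : Type*} (p : B → σ) (K : Type*) [Field K] [Algebra (RatField σ) K]

theorem injective_algebraMap_mvPolynomial :
    Function.Injective ((algebraMap (RatField σ) K).comp
      (algebraMap (MvPolynomial σ ℂ) (RatField σ))) :=
  (algebraMap (RatField σ) K).injective.comp (IsFractionRing.injective _ _)

theorem param_ne_zero (s : B) : param p K s ≠ 0 := by
  have := (map_ne_zero_iff _ (injective_algebraMap_mvPolynomial (σ := σ) K)).mpr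
    (MvPolynomial.X_ne_zero (R := ℂ) (p s))
  exact this

theorem charZero_of_algebra_ratField (σ : Type*) (K : Type*) [Field K] [Algebra (RatField σ) K] :
    CharZero K :=
  charZero_of_injective_ringHom (injective_algebraMap_mvPolynomial (σ := σ) K)

/-- It is the image of a polynomial whose value at `u_s = 1` is the order of `W_J`. -/
theorem poincare_param_ne_zero {W : Type*} [Group W] [Fintype W] {M : CoxeterMatrix B}
    (cs : CoxeterSystem M W) (J : Set B) : poincare cs (param p K) J ≠ 0 := by
  classical
  let q (w : W) : MvPolynomial σ ℂ := ((reducedWord cs w).map fun s => MvPolynomial.X (p s)).prod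
  have hq : poincare cs (param p K) J = (algebraMap (RatField σ) K).comp
      (algebraMap (MvPolynomial σ ℂ) (RatField σ))
      (∑ w ∈ Finset.univ.filter (fun w : W => w ∈ parabolic cs J), q w) := by
    rw [map_sum, poincare]
    refine Finset.sum_congr (by congr) fun w _ => ?_
    rw [map_list_prod, List.map_map]
    rfl
  rw [hq, map_ne_zero_iff _ (injective_algebraMap_mvPolynomial K)]
  intro h
  have h1 := congrArg (MvPolynomial.eval fun _ => (1 : ℂ)) h
  have h2 (w : W) : MvPolynomial.eval (fun _ => (1 : ℂ)) (q w) = 1 := by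
    rw [map_list_prod, List.map_map]
    apply List.prod_eq_one
    simp
  rw [map_sum, map_zero] at h1
  simp only [h2, Finset.sum_const, nsmul_eq_mul, mul_one, Nat.cast_eq_zero,
    Finset.card_eq_zero] at h1
  have h3 : (1 : W) ∈ Finset.univ.filter (fun w : W => w ∈ parabolic cs J) := by
    simp [one_mem]
  rw [h1] at h3
  simp at h3

end Generic

end IwahoriHecke

theorem theorem3p3 {B W σ : Type*} [Group W] [Fintype W] {M : CoxeterMatrix B}
    (cs : CoxeterSystem M W)
    (p : B → σ) (hp : Function.Surjective p)
    (hconj : ∀ s t : B, IsConj (cs.simple s) (cs.simple t) → p s = p t)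
    (K : Type*) [Field K] [Algebra (IwahoriHecke.RatField σ) K]
    [FiniteDimensional (IwahoriHecke.RatField σ) K] [IsGalois (IwahoriHecke.RatField σ) K]
    (hK : IwahoriHecke.SimplesSplit K (IwahoriHecke.GenericHecke M p K))
    (J : Set B) (hJ : IwahoriHecke.IsGelfandPair cs (IwahoriHecke.param p K) J)
    (r : ℕ)
    (V : Fin r →
      Submodule (IwahoriHecke.GenericHecke M p K)ᵐᵒᵖ (IwahoriHecke.GenericHecke M p K))
    (hsimple : ∀ i, IsSimpleModule (IwahoriHecke.GenericHecke M p K)ᵐᵒᵖ (V i))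
    (hindep : iSupIndep V)
    (hsup : ⨆ i, V i = IwahoriHecke.eJH cs (IwahoriHecke.param p K) J) :
    (∃ b : Module.Basis W K (IwahoriHecke.GenericHecke M p K),
      (∀ w, b w = IwahoriHecke.T cs (IwahoriHecke.param p K) w) ∧
      ∀ i, b.repr (IwahoriHecke.zonal cs (IwahoriHecke.param p K) J (V i)) 1 = 1) ∧
    (∃ c : Fin r → K,
      (∀ i (x : K), IwahoriHecke.IsSchurElement cs (IwahoriHecke.param p K) (V i) x ↔ x = c i) ∧
      ∀ i j, IwahoriHecke.zonal cs (IwahoriHecke.param p K) J (V i) *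
          IwahoriHecke.zonal cs (IwahoriHecke.param p K) J (V j) =
        if i = j then c i • IwahoriHecke.zonal cs (IwahoriHecke.param p K) J (V i) else 0) ∧
    (∀ i, IwahoriHecke.zonal cs (IwahoriHecke.param p K) J (V i) ∈
        IwahoriHecke.eJHeJ cs (IwahoriHecke.param p K) J ∧
      IwahoriHecke.zonal cs (IwahoriHecke.param p K) J (V i) ∈ V i) ∧
    (∃ b : Module.Basis (Fin r) K (IwahoriHecke.eJHeJ cs (IwahoriHecke.param p K) J),
      ∀ i, (b i : IwahoriHecke.GenericHecke M p K) =
        IwahoriHecke.zonal cs (IwahoriHecke.param p K) J (V i)) := by 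
  classical
  have ha (s t : B) (h : IsConj (cs.simple s) (cs.simple t)) :
      IwahoriHecke.param p K s = IwahoriHecke.param p K t := by
    rw [IwahoriHecke.param, IwahoriHecke.param, hconj s t h]
  have hchar := IwahoriHecke.charZero_of_algebra_ratField σ K
  have ha0 := IwahoriHecke.param_ne_zero p K
  have hP := IwahoriHecke.poincare_param_ne_zero p K cs J
  have he := IwahoriHecke.eJ_mul_eJ cs ha ha0 hP
  have hb := IwahoriHecke.isSymmetrizing_TDual cs ha ha0
  have hfin : Module.Finite K (IwahoriHecke.GenericHecke M p K) :=
    Module.Finite.of_basis (IwahoriHecke.basisT cs ha)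
  have hfinV := fun i => Submodule.finite_of_mulOpposite (K := K) (V i)
  have hntV := fun i => IsSimpleModule.nontrivial (IwahoriHecke.GenericHecke M p K)ᵐᵒᵖ (V i)
  have hle (i : Fin r) : V i ≤ IwahoriHecke.eJH cs (IwahoriHecke.param p K) J :=
    hsup ▸ le_iSup V i
  have hhom (i j : Fin r) (hij : i ≠ j)
      (φ : V i →ₗ[(IwahoriHecke.GenericHecke M p K)ᵐᵒᵖ] V j) : φ = 0 :=
    IwahoriHecke.IsMultiplicityFree.hom_eq_zero hJ (hle i) (hle j)
      ((hindep.injective_of_isSimpleModule hsimple).ne hij) φ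
  obtain ⟨x, hx, hxe⟩ := exists_component hsup
  have hschur (i : Fin r) :
      ∃ c : K, IwahoriHecke.IsSchurElement cs (IwahoriHecke.param p K) (V i) c := by
    obtain ⟨c, hc⟩ := hb.exists_schurElement (V := V i) (hK.exists_smul (V i))
    exact ⟨c, fun φ v => by simpa only [IwahoriHecke.basisT_apply] using hc φ v⟩
  choose c hc using hschur
  have hstar (i : Fin r) : IwahoriHecke.star cs (IwahoriHecke.param p K)
      (IwahoriHecke.character K (V i)) =
      ∑ w, IwahoriHecke.character K (V i) (IwahoriHecke.basisT cs ha w) •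
        IwahoriHecke.TDual cs (IwahoriHecke.param p K) w := by
    simp only [IwahoriHecke.basisT_apply]
    rfl
  have hω (i : Fin r) : IwahoriHecke.zonal cs (IwahoriHecke.param p K) J (V i) = c i • x i := by
    rw [IwahoriHecke.zonal, hstar]
    refine hb.sum_character_mul_eq_smul_component hhom hx hxe fun φ v => ?_
    simpa only [IwahoriHecke.basisT_apply] using hc i φ v
  have hone (i : Fin r) : (IwahoriHecke.basisT cs ha).repr
      (IwahoriHecke.zonal cs (IwahoriHecke.param p K) J (V i)) 1 = 1 := by
    rw [IwahoriHecke.zonal, hstar]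
    refine (hb.trace_sum_smul_dual (characterLinear K (V i)) _).trans ?_
    exact character_idempotent_eq_one hK he hindep hsup hsimple hhom hx hxe i
  have hc0 (i : Fin r) : c i ≠ 0 := by
    intro h
    have := hone i
    rw [hω, h, zero_smul] at this
    simp at this
  have hli := linearIndependent_component (K := K) he hindep hsup hsimple hx hxe
  have hrange : IwahoriHecke.eJHeJ cs (IwahoriHecke.param p K) J = Submodule.span K (Set.range x) :=
    range_mulLeftRight_eq_span_component hK he hindep hsup hsimple hhom hx hxe
  refine ⟨⟨IwahoriHecke.basisT cs ha, IwahoriHecke.basisT_apply cs ha, hone⟩, ⟨c, ?_, ?_⟩, ?_, ?_⟩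
  · intro i y
    refine ⟨fun hy => ?_, fun hy => hy ▸ hc i⟩
    obtain ⟨v, hv⟩ := exists_ne (0 : V i)
    -- A rank-one endomorphism of trace one isolates the Schur element, so it is unique.
    obtain ⟨f, hf⟩ := Module.Projective.exists_dual_eq_one K hv
    have h1 := (hy (f.smulRight v) v).symm.trans (hc i (f.smulRight v) v)
    rw [LinearMap.trace_smulRight, hf, mul_one, mul_one] at h1
    exact smul_left_injective K hv h1
  · intro i j
    rw [hω, hω, smul_mul_smul_comm, component_mul he hindep hsup hx hxe (hx j)]
    split_ifs with h
    · subst h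
      rw [smul_smul]
    · rw [smul_zero]
  · intro i
    rw [hω]
    refine ⟨?_, ?_⟩
    · rw [hrange]
      exact Submodule.smul_mem _ _ (Submodule.subset_span ⟨i, rfl⟩)
    · rw [← mul_one (x i), ← mul_smul_comm]
      exact mul_mem_of_mem_left (hx i) _
  · let e := (Module.Basis.span hli).map (LinearEquiv.ofEq _ _ hrange.symm)
    have he' (i : Fin r) : (e i : IwahoriHecke.GenericHecke M p K) = x i := by
      simp [e, Module.Basis.span_apply]
    refine ⟨e.unitsSMul fun i => Units.mk0 (c i) (hc0 i), fun i => ?_⟩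
    rw [Module.Basis.unitsSMul_apply, hω]
    change c i • (e i : IwahoriHecke.GenericHecke M p K) = _
    rw [he']
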